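/- Let $d\ge 1$, let $\mathbb S^d$ be the unit sphere of $\mathbb R^{d+1}$ with geodesic distance $d_s$ and surface measure $\sigma_d$, let $\omega_n$ be the surface area of the unit sphere in $\mathbb R^n$, and put $B(x,r)=\{y\in\mathbb S^d: d_s(x,y)\le r\}$. For $\bar o\in\mathbb S^d$ and a closed set $K\subset\mathbb S^d$ with $\bar o\in K$ let $$r_{\bar o}(K)=\max\{r\in[0,\pi]: B(\bar o,r)\subset K\},\qquad R_{\bar o}(K)=\min\{r\ge 0: K\subset B(\bar o,r)\}.$$ Let $X$ be an isotropic Poisson process on $\mathbb S^d$ with intensity $\gamma_s\in(0,\infty)$, that is, a finite random set of points with intensity measure $\gamma_s\sigma_d$: the number of points in a Borel set $A$ is Poisson distributed with parameter $\gamma_s\sigma_d(A)$, and the numbers of points in pairwise disjoint Borel sets are independent. The Voronoi cell of $x\in X$ is $C(x,X)=\{y\in\mathbb S^d: d_s(y,x)\le d_s(y,z)\text{ for all }z\in X\}$. The distribution of the typical cell $Z$ of the Poisson–Voronoi tessellation (with respect to $\bar o$) is $$\mathbb P(Z\in\cdot)=\frac1{\gamma_s\omega_{d+1}}\,\mathbb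 E\sum_{x\in X}\int_{SO_{d+1}}\mathbf 1\{\varphi^{-1}C(x,X)\in\cdot\}\,\kappa(x,d\varphi),$$ where $\kappa(x,\cdot)$ is the image of the invariant probability measure on the stabilizer $\{\psi\in SO_{d+1}:\psi\bar o=\bar o\}$ under $\psi\mapsto\varphi_x\psi$, for any $\varphi_x\in SO_{d+1}$ with $\varphi_x\bar o=x$. **Theorem.** For every $d\ge1$ and $0<a<\pi/2$ there is a constant $c_{16}>0$, depending only on $a,d$, with $$c_{16}\ \ge\ \pi^{-4d}\,\omega_d\,a^{d-1}\bigl(\min\{a,\tfrac{\pi}{2}-a\}\bigr)^{d-1},$$ such that for every $\varepsilon\in(0,1]$ there is a constant $c_{15}>0$, depending only on $a,d,\varepsilon$, with the following property: for every $\bar o\in\mathbb S^d$, every $\gamma_s\in(0,\infty)$ and every isotropic Poisson process $X$ on $\mathbb S^d$ with intensity $\gamma_s$, the typical cell $Z$ satisfies $\mathbb P(r_{\bar o}(Z)\ge a)>0$ and $$\mathbb P\bigl(R_{\bar o}(Z)-r_{\bar o}(Z)\ge\varepsilon \,\big|\, r_{\bar o}(Z)\ge a\bigr)\ \le\ c_{15}\exp\bigl(-c_{16}\,\varepsilon^{\frac{d+1}{2}}\,\gamma_s\bigr).$$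 -/

import Mathlib

open MeasureTheory ProbabilityTheory Set
open scoped ENNReal Pointwise

noncomputable section

namespace SphericalVoronoi

/-- The Euclidean space `ℝ^(d+1)`. -/
abbrev E (d : ℕ) : Type := EuclideanSpace ℝ (Fin (d + 1))

/-- The unit sphere `S^d` in `ℝ^(d+1)`. -/
abbrev Sph (d : ℕ) : Type := Metric.sphere (0 : E d) 1

/-- The spherical Lebesgue measure `σ_d` (surface measure of the unit sphere in `ℝ^(d+1)`). -/
def sigma (d : ℕ) : Measure (Sph d) := (volume : Measure (E d)).toSphere

/-- The surface area `ω_n` of the unit sphere in `ℝ^n`. -/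
def omega (n : ℕ) : ℝ :=
  ((volume : Measure (EuclideanSpace ℝ (Fin n))).toSphere).real univ

/-- The geodesic distance on the sphere. -/
def geodist {d : ℕ} (x y : Sph d) : ℝ := InnerProductGeometry.angle (x : E d) (y : E d)

/-- The closed geodesic ball `B(x, r)`. -/
def capBall {d : ℕ} (x : Sph d) (r : ℝ) : Set (Sph d) := {y | geodist x y ≤ r}

/-- The inradius of `K` centred at `o`: the largest radius `0 ≤ r ≤ π` with `B(o, r) ⊆ K`. -/
def inrad {d : ℕ} (o : Sph d) (K : Set (Sph d)) : ℝ :=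
  sSup {r : ℝ | 0 ≤ r ∧ r ≤ Real.pi ∧ capBall o r ⊆ K}

/-- The circumradius of `K` centred at `o`: the smallest radius `r ≥ 0` with `K ⊆ B(o, r)`. -/
def circumrad {d : ℕ} (o : Sph d) (K : Set (Sph d)) : ℝ :=
  sInf {r : ℝ | 0 ≤ r ∧ K ⊆ capBall o r}

/-- The Voronoi cell `C(x, A)` of the nucleus `x` in the finite set `A`. -/
def voronoiCell {d : ℕ} (x : Sph d) (A : Finset (Sph d)) : Set (Sph d) :=
  {y | ∀ z ∈ A, geodist y x ≤ geodist y z}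

/-! ### The rotation group -/

/-- The group `SO_{d+1}` of proper rotations of `ℝ^(d+1)`, with the topology of matrices. -/
abbrev SO (d : ℕ) : Type := Matrix.specialOrthogonalGroup (Fin (d + 1)) ℝ

instance (d : ℕ) : IsTopologicalGroup (SO d) where
  continuous_mul := by
    refine Continuous.subtype_mk ?_ _
    fun_prop
  continuous_inv := by
    refine Continuous.subtype_mk ?_ _
    exact continuous_star.comp continuous_subtype_val

instance (d : ℕ) : CompactSpace (SO d) := by
  let M := Matrix (Fin (d + 1)) (Fin (d + 1)) ℝ
  let G : Set M := {A | A ∈ Matrix.specialOrthogonalGroup (Fin (d + 1)) ℝ}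
  let C : Set M := Set.univ.pi (fun _ => Set.univ.pi (fun _ => Set.Icc (-1 : ℝ) 1))
  have hC : IsCompact C :=
    isCompact_univ_pi fun _ => isCompact_univ_pi fun _ => isCompact_Icc
  have hsub : G ⊆ C := by
    intro A hA i _ j _
    have h := Matrix.mem_unitaryGroup_iff.1 (Matrix.mem_specialOrthogonalGroup_iff.1 hA).1
    have h1 := congrFun (congrFun h i) i
    simp only [Matrix.mul_apply, Matrix.star_apply, star_trivial, Matrix.one_apply_eq] at h1
    have h2 : A i j * A i j ≤ 1 := by
      rw [← h1]
      exact Finset.single_le_sum (f := fun k => A i k * A i k)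
        (fun k _ => mul_self_nonneg _) (Finset.mem_univ j)
    exact abs_le.1 (abs_le_one_iff_mul_self_le_one.2 h2)
  have hG : G = {A : M | A * star A = 1} ∩ {A : M | A.det = 1} := by
    ext A
    exact Matrix.mem_specialOrthogonalGroup_iff.trans
      (and_congr_left fun _ => Matrix.mem_unitaryGroup_iff)
  have hcl : IsClosed G := by
    rw [hG]
    exact (isClosed_eq (continuous_id.mul continuous_star) continuous_const).inter
      (isClosed_eq (Continuous.matrix_det continuous_id) continuous_const)
  exact isCompact_iff_compactSpace.1 (hC.of_isClosed_subset hcl hsub)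

instance (d : ℕ) : MeasurableSpace (SO d) := borel _

instance (d : ℕ) : BorelSpace (SO d) := ⟨rfl⟩

theorem norm_toEuclideanLin {d : ℕ} (φ : SO d) (x : E d) :
    ‖Matrix.toEuclideanLin φ.1 x‖ = ‖x‖ := by
  have h := Matrix.mem_unitaryGroup_iff'.1 (Matrix.mem_specialOrthogonalGroup_iff.1 φ.2).1
  have h' : φ.1.transpose * φ.1 = 1 := h
  have key : ‖Matrix.toEuclideanLin φ.1 x‖ ^ 2 = ‖x‖ ^ 2 := by
    rw [EuclideanSpace.real_norm_sq_eq, EuclideanSpace.real_norm_sq_eq]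
    have e1 : ∀ v : Fin (d + 1) → ℝ, ∑ i, v i ^ 2 = v ⬝ᵥ v := fun v => by
      simp [dotProduct, sq]
    rw [e1, e1]
    change (φ.1.mulVec x.ofLp) ⬝ᵥ (φ.1.mulVec x.ofLp) = x.ofLp ⬝ᵥ x.ofLp
    rw [Matrix.dotProduct_mulVec, Matrix.vecMul_mulVec, ← Matrix.dotProduct_mulVec, h',
      Matrix.one_mulVec]
  exact (sq_eq_sq₀ (norm_nonneg _) (norm_nonneg _)).1 key

/-- The action of rotations on the sphere, `φ • x = φ x`. -/
instance (d : ℕ) : MulAction (SO d) (Sph d) where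
  smul φ x := ⟨Matrix.toEuclideanLin φ.1 (x : E d), by
    rw [mem_sphere_zero_iff_norm, norm_toEuclideanLin]
    exact mem_sphere_zero_iff_norm.1 x.2⟩
  one_smul x := by
    apply Subtype.ext
    change Matrix.toEuclideanLin (1 : Matrix (Fin (d + 1)) (Fin (d + 1)) ℝ) (x : E d) = x
    simp [Matrix.toLpLin_one]
  mul_smul φ ψ x := by
    apply Subtype.ext
    change Matrix.toEuclideanLin (φ.1 * ψ.1) (x : E d) =
      Matrix.toEuclideanLin φ.1 (Matrix.toEuclideanLin ψ.1 (x : E d))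
    simp [Matrix.toLpLin_apply, Matrix.mulVec_mulVec]

theorem continuous_smul_const {d : ℕ} (o : Sph d) : Continuous (fun φ : SO d => φ • o) := by
  refine Continuous.subtype_mk ?_ _
  refine (PiLp.continuous_toLp 2 _).comp ?_
  exact Continuous.matrix_mulVec continuous_subtype_val continuous_const

/-- The stabilizer `{φ ∈ SO_{d+1} : φ o = o}`. -/
abbrev Stab {d : ℕ} (o : Sph d) : Subgroup (SO d) := MulAction.stabilizer (SO d) o

instance {d : ℕ} (o : Sph d) : CompactSpace (Stab o) :=
  isCompact_iff_compactSpace.1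
    (isClosed_singleton.preimage (continuous_smul_const o)).isCompact

/-- The invariant probability measure on the stabilizer of `o`. -/
def stabHaar {d : ℕ} (o : Sph d) : Measure (Stab o) := Measure.haarMeasure ⊤

/-- A chosen rotation `φ_x` with `φ_x o = x` (it exists when `d ≥ 1`). -/
def rotTo {d : ℕ} (o x : Sph d) : SO d := Function.invFun (fun φ : SO d => φ • o) x

/-- The kernel `κ(x, ·)`: the probability measure on `SO_{d+1}` that is concentrated on
`{φ : φ o = x}`, namely the image of the invariant probability measure of the stabilizer
of `o` under `ψ ↦ φ_x ψ`. It does not depend on the choice of `φ_x`. -/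
def kappa {d : ℕ} (o x : Sph d) : Measure (SO d) :=
  (stabHaar o).map (fun ψ : Stab o => rotTo o x * (ψ : SO d))

/-! ### Poisson processes and the typical Voronoi cell -/

/-- The number of points of a finite set in `A`. -/
def count {d : ℕ} (s : Finset (Sph d)) (A : Set (Sph d)) : ℕ := ((s : Set (Sph d)) ∩ A).ncard

/-- `X` is an isotropic Poisson process on `S^d` of intensity `γ`, viewed as a finite random
collection of points: counts are random variables, the number of points in a Borel set `A` is
Poisson distributed with parameter `γ σ_d(A)`, and the numbers of points in pairwise disjoint
Borel sets are independent. -/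
structure IsPoissonProcess {d : ℕ} {Ω : Type*} [MeasurableSpace Ω] (P : Measure Ω)
    (X : Ω → Finset (Sph d)) (γ : ℝ) : Prop where
  measurable_count : ∀ A : Set (Sph d), MeasurableSet A → Measurable fun ω => count (X ω) A
  law_count : ∀ A : Set (Sph d), MeasurableSet A →
    P.map (fun ω => count (X ω) A) = poissonMeasure (γ * (sigma d).real A).toNNReal
  indep_count : ∀ (n : ℕ) (A : Fin n → Set (Sph d)), (∀ i, MeasurableSet (A i)) →
    Pairwise (fun i j => Disjoint (A i) (A j)) → iIndepFun (fun i ω => count (X ω) (A i)) P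

/-- The distribution of the typical cell `Z` of the Voronoi tessellation generated by `X`:
`P(Z ∈ B) = (γ ω_{d+1})⁻¹ E ∑_{x ∈ X} ∫ 1{φ⁻¹ C(x, X) ∈ B} κ(x, dφ)`,
the normalized mark distribution in which the cell of each nucleus `x` is rotated back by a
uniform random rotation taking `o` to `x`. -/
def typicalCellProb {d : ℕ} {Ω : Type*} [MeasurableSpace Ω] (P : Measure Ω)
    (X : Ω → Finset (Sph d)) (γ : ℝ) (o : Sph d) (B : Set (Set (Sph d))) : ℝ≥0∞ :=
  (ENNReal.ofReal (γ * omega (d + 1)))⁻¹ *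
    ∫⁻ ω, ∑ x ∈ X ω, kappa o x {φ | φ⁻¹ • voronoiCell x (X ω) ∈ B} ∂P

/-- The conditional probability `P(Z ∈ A ∣ Z ∈ B)` for the typical cell `Z`. -/
def typicalCellCondProb {d : ℕ} {Ω : Type*} [MeasurableSpace Ω] (P : Measure Ω)
    (X : Ω → Finset (Sph d)) (γ : ℝ) (o : Sph d) (A B : Set (Set (Sph d))) : ℝ≥0∞ :=
  typicalCellProb P X γ o (A ∩ B) / typicalCellProb P X γ o B

end SphericalVoronoi

end

/-!
The cell of a point `x` contains the ball `B(x, a)` exactly if all other points of the process have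
distance at least `2a` from `x`. Conditioning on this event removes the factor
`exp (-γ σ(B(x, 2a)))`, so the deviation estimate says that a cell with inradius at least `a` and
circumradius exceeding the inradius by `ε` forces an additional empty region of measure of order
`ε ^ ((d + 1) / 2)`.

*Geometry.* If `R - r ≥ ε` and `r ≥ a`, then the cell has a point at distance at least `a + ε` from
its nucleus. Sliding this point along a geodesic towards `x` gives a point `y` with
`d_s(x, y) = a + ε` around which the open ball of radius `a + ε` is empty
(`exists_empty_ball_of_le_circumrad_sub_inrad`). The same lemma shows `ε ≤ π - 2a`, because the
perimeter of a spherical triangle is at most `2π`; for larger `ε` the event is empty. The lens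
`B(y, a + ε) \ B(x, 2a)` is measured in polar coordinates around `x` (`sigma_polar`), in which the
surface measure is `sin ^ (d - 1) t dt` times the surface measure of directions: for each
`t ∈ (2a, 2a + ε / 2]` the lens contains a cap of directions of angular radius of order `√ε`
(`sigma_real_lens_ge`). The factor `ω_d` in the constant comes from the directions, the factor
`min {a, π / 2 - a} ^ (d - 1)` from the density, and the constant obtained is strictly larger than
the prescribed one (`prescribed_constant_lt`).

*Probability.* The random rotations drop out of the law of the two radii
(`typicalCellProb_radii`), which leaves the mean of a sum over the points of the process. In place
of the Mecke formula, the sphere is cut into finitely many pieces `A i` of radius `δ`. If `A i`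
contains exactly one point and its neighbourhood no other point, the cell of that point contains
the ball of radius `a`; this gives the lower bound `exp (-γ σ(B(o, 2a + δ)))` for the conditioning
event (`ofReal_exp_le_typicalCellProb`). Conversely, a point of `A i` whose cell is counted in the
numerator forces one of finitely many slightly shrunk unions of two balls, disjoint from `A i`, to
be empty, and the independence of counts bounds the expected number of such points
(`exists_typicalCellProb_le`). As the lens bound is strictly better than required, one fixed mesh
`δ`, depending only on `a`, `d` and `ε`, absorbs all errors of this discretization.
-/

noncomputable section

namespace SphericalVoronoi

/-! ### Geodesic distance on the sphere -/

section Geodesic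

variable {d : ℕ}

theorem norm_coe_sph (x : Sph d) : ‖(x : E d)‖ = 1 := mem_sphere_zero_iff_norm.1 x.2

theorem coe_sph_ne_zero (x : Sph d) : (x : E d) ≠ 0 := by
  rw [← norm_ne_zero_iff, norm_coe_sph]
  exact one_ne_zero

theorem geodist_eq_arccos (x y : Sph d) :
    geodist x y = Real.arccos (inner ℝ (x : E d) (y : E d)) := by
  simp [geodist, InnerProductGeometry.angle]

theorem cos_geodist (x y : Sph d) :
    Real.cos (geodist x y) = inner ℝ (x : E d) (y : E d) := by
  rw [geodist, InnerProductGeometry.cos_angle, norm_coe_sph, norm_coe_sph, mul_one, div_one]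

theorem geodist_nonneg (x y : Sph d) : 0 ≤ geodist x y := InnerProductGeometry.angle_nonneg _ _

theorem geodist_le_pi (x y : Sph d) : geodist x y ≤ Real.pi := InnerProductGeometry.angle_le_pi _ _

theorem geodist_comm (x y : Sph d) : geodist x y = geodist y x :=
  InnerProductGeometry.angle_comm _ _

theorem geodist_triangle (x y z : Sph d) : geodist x z ≤ geodist x y + geodist y z :=
  InnerProductGeometry.angle_le_angle_add_angle _ _ _

theorem geodist_self (x : Sph d) : geodist x x = 0 :=
  InnerProductGeometry.angle_self (coe_sph_ne_zero x)

theorem geodist_neg_right (x y : Sph d) : geodist x (-y) = Real.pi - geodist x y :=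
  InnerProductGeometry.angle_neg_right _ _

theorem geodist_neg_left (x y : Sph d) : geodist (-x) y = Real.pi - geodist x y :=
  InnerProductGeometry.angle_neg_left _ _

theorem geodist_pos {x y : Sph d} (h : x ≠ y) : 0 < geodist x y := by
  refine lt_of_le_of_ne (geodist_nonneg x y) fun h0 => h (Subtype.ext ?_)
  have h1 := cos_geodist x y
  rw [← h0, Real.cos_zero] at h1
  exact (inner_eq_one_iff_of_norm_eq_one (norm_coe_sph x) (norm_coe_sph y)).1 h1.symm

theorem continuous_geodist {α : Type*} [TopologicalSpace α] {f g : α → Sph d}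
    (hf : Continuous f) (hg : Continuous g) : Continuous fun t => geodist (f t) (g t) := by
  simp only [geodist_eq_arccos]
  exact Real.continuous_arccos.comp
    ((continuous_subtype_val.comp hf).inner (continuous_subtype_val.comp hg))

theorem isClosed_capBall (x : Sph d) (r : ℝ) : IsClosed (capBall x r) :=
  isClosed_le (continuous_geodist continuous_const continuous_id) continuous_const

theorem measurableSet_capBall (x : Sph d) (r : ℝ) : MeasurableSet (capBall x r) :=
  (isClosed_capBall x r).measurableSet

theorem mem_capBall {x y : Sph d} {r : ℝ} : y ∈ capBall x r ↔ geodist x y ≤ r := Iff.rfl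

/-- A spherical triangle has perimeter at most `2π`. -/
theorem geodist_perimeter (x y z : Sph d) :
    geodist x y + geodist y z + geodist x z ≤ 2 * Real.pi := by
  have h := geodist_triangle x (-y) z
  rw [geodist_neg_right, geodist_neg_left] at h
  linarith

theorem exists_unit_orthogonal (hd : 1 ≤ d) (x : Sph d) :
    ∃ u : E d, ‖u‖ = 1 ∧ inner ℝ (x : E d) u = 0 := by
  have hr : Module.finrank ℝ (ℝ ∙ (x : E d))ᗮ = d := by
    have := Fact.mk (finrank_euclideanSpace_fin (𝕜 := ℝ) (n := d + 1))
    exact Submodule.finrank_orthogonal_span_singleton (coe_sph_ne_zero x)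
  have hp : 0 < Module.finrank ℝ (ℝ ∙ (x : E d))ᗮ := by omega
  have := Module.finrank_pos_iff.1 hp
  obtain ⟨v, hv⟩ := exists_ne (0 : (ℝ ∙ (x : E d))ᗮ)
  have hv' : ‖(v : E d)‖ ≠ 0 := by simpa using hv
  refine ⟨(‖(v : E d)‖)⁻¹ • (v : E d), ?_, ?_⟩
  · rw [norm_smul, norm_inv, norm_norm, inv_mul_cancel₀ hv']
  · rw [inner_smul_right, Submodule.mem_orthogonal_singleton_iff_inner_right.1 v.2, mul_zero]

/-- Polar decomposition of a point of the sphere around `x`. -/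
theorem exists_direction (hd : 1 ≤ d) (x y : Sph d) :
    ∃ u : E d, ‖u‖ = 1 ∧ inner ℝ (x : E d) u = 0 ∧
      (y : E d) = Real.cos (geodist x y) • (x : E d) + Real.sin (geodist x y) • u := by
  set t := geodist x y with ht
  set w : E d := (y : E d) - Real.cos t • (x : E d) with hw
  have hxw : inner ℝ (x : E d) w = 0 := by
    rw [hw, inner_sub_right, inner_smul_right, real_inner_self_eq_norm_sq, norm_coe_sph, ht,
      cos_geodist]
    ring
  have hyw : (y : E d) = Real.cos t • (x : E d) + w := by rw [hw]; abel
  have hnw : ‖w‖ = Real.sin t := by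
    have h1 : ‖(y : E d)‖ * ‖(y : E d)‖ = _ := congrArg (fun v => ‖v‖ * ‖v‖) hyw
    rw [norm_add_sq_eq_norm_sq_add_norm_sq_of_inner_eq_zero _ _
      (by rw [real_inner_smul_left, hxw, mul_zero]), norm_smul, norm_coe_sph, norm_coe_sph,
      Real.norm_eq_abs, mul_one, mul_one, abs_mul_abs_self] at h1
    have h2 := Real.sin_sq_add_cos_sq t
    have h3 : 0 ≤ Real.sin t := InnerProductGeometry.sin_angle_nonneg _ _
    exact (sq_eq_sq₀ (norm_nonneg _) h3).1 (by nlinarith)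
  by_cases h0 : Real.sin t = 0
  · obtain ⟨u, hu, hxu⟩ := exists_unit_orthogonal hd x
    refine ⟨u, hu, hxu, ?_⟩
    rw [h0] at hnw ⊢
    rw [norm_eq_zero.1 hnw] at hyw
    simpa using hyw
  · refine ⟨(Real.sin t)⁻¹ • w, ?_, by rw [inner_smul_right, hxw, mul_zero], ?_⟩
    · rw [norm_smul, hnw, norm_inv, Real.norm_eq_abs, ← hnw, abs_norm, hnw, inv_mul_cancel₀ h0]
    · rw [smul_inv_smul₀ h0]
      exact hyw

theorem norm_cos_smul_add_sin_smul {x u : E d} (hx : ‖x‖ = 1) (hu : ‖u‖ = 1)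
    (hxu : inner ℝ x u = 0) (s : ℝ) : ‖Real.cos s • x + Real.sin s • u‖ = 1 := by
  have h : ‖Real.cos s • x + Real.sin s • u‖ * ‖Real.cos s • x + Real.sin s • u‖ = 1 := by
    rw [norm_add_sq_eq_norm_sq_add_norm_sq_of_inner_eq_zero _ _
      (by rw [real_inner_smul_left, inner_smul_right, hxu, mul_zero, mul_zero]),
      norm_smul, norm_smul, hx, hu, Real.norm_eq_abs, Real.norm_eq_abs, mul_one, mul_one,
      abs_mul_abs_self, abs_mul_abs_self]
    nlinarith [Real.sin_sq_add_cos_sq s]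
  nlinarith [norm_nonneg (Real.cos s • x + Real.sin s • u)]

/-- Points of a minimal geodesic: every `s` between `0` and `d_s(x, y)` is the distance from `x`
of a point which is at distance `d_s(x, y) - s` from `y`. -/
theorem exists_between (hd : 1 ≤ d) (x y : Sph d) {s : ℝ} (hs : 0 ≤ s) (hsy : s ≤ geodist x y) :
    ∃ w : Sph d, geodist x w = s ∧ geodist w y = geodist x y - s := by
  obtain ⟨u, hu, hxu, hy⟩ := exists_direction hd x y
  have hpi := geodist_le_pi x y
  refine ⟨⟨Real.cos s • (x : E d) + Real.sin s • u, mem_sphere_zero_iff_norm.2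
    (norm_cos_smul_add_sin_smul (norm_coe_sph x) hu hxu s)⟩, ?_, ?_⟩
  · rw [geodist_eq_arccos]
    simp only
    rw [inner_add_right, inner_smul_right, inner_smul_right, hxu, real_inner_self_eq_norm_sq,
      norm_coe_sph, one_pow, mul_one, mul_zero, add_zero, Real.arccos_cos hs (by linarith)]
  · rw [geodist_eq_arccos]
    simp only
    have hux : inner ℝ u (x : E d) = 0 := by rw [real_inner_comm, hxu]
    rw [hy, inner_add_left, inner_add_right, inner_add_right]
    simp only [real_inner_smul_left, inner_smul_right, hxu, hux, real_inner_self_eq_norm_sq,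
      norm_coe_sph, hu]
    rw [← Real.arccos_cos (sub_nonneg.2 hsy) (by linarith), Real.cos_sub]
    congr 1
    ring

end Geodesic

/-! ### Rotations -/

section Rotation

variable {d : ℕ}

theorem coe_smul_sph (φ : SO d) (x : Sph d) :
    ((φ • x : Sph d) : E d) = Matrix.toEuclideanLin φ.1 (x : E d) := rfl

theorem geodist_smul_smul (φ : SO d) (x y : Sph d) : geodist (φ • x) (φ • y) = geodist x y := by
  let f : E d →ₗᵢ[ℝ] E d := ⟨Matrix.toEuclideanLin φ.1, norm_toEuclideanLin φ⟩
  exact f.angle_map (x : E d) (y : E d)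

theorem exists_smul_eq_sph (hd : 1 ≤ d) (o x : Sph d) : ∃ φ : SO d, φ • o = x := by
  by_cases hox : o = x
  · exact ⟨1, by rw [one_smul, hox]⟩
  obtain ⟨u, hu, hxu⟩ := exists_unit_orthogonal hd x
  have hu0 : u ≠ 0 := by rw [← norm_ne_zero_iff, hu]; exact one_ne_zero
  have hw0 : (o : E d) - x ≠ 0 := sub_ne_zero.2 fun h => hox (Subtype.ext h)
  -- `r₁` swaps `o` and `x`, and `r₂` fixes `x`; their composition has determinant one
  let r₁ := (ℝ ∙ ((o : E d) - x))ᗮ.reflection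
  let r₂ := (ℝ ∙ u)ᗮ.reflection
  let g : E d ≃ₗᵢ[ℝ] E d := r₁.trans r₂
  have hdet : LinearMap.det (g.toLinearEquiv : E d →ₗ[ℝ] E d) = 1 := by
    have h1 : (g.toLinearEquiv : E d →ₗ[ℝ] E d) = r₂.toLinearEquiv.toLinearMap ∘ₗ
      r₁.toLinearEquiv.toLinearMap := rfl
    rw [h1, LinearMap.det_comp]
    have e1 := (ℝ ∙ ((o : E d) - x))ᗮ.det_reflection
    have e2 := (ℝ ∙ u)ᗮ.det_reflection
    rw [Submodule.orthogonal_orthogonal, finrank_span_singleton hw0] at e1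
    rw [Submodule.orthogonal_orthogonal, finrank_span_singleton hu0] at e2
    change LinearMap.det r₂.toLinearMap * LinearMap.det r₁.toLinearMap = 1
    rw [e1, e2]
    norm_num
  have hgo : g o = x := by
    change r₂ (r₁ o) = x
    have h1 : r₁ o = x := Submodule.reflection_sub (by rw [norm_coe_sph, norm_coe_sph])
    rw [h1]
    refine Submodule.reflection_mem_subspace_eq_self ?_
    rw [Submodule.mem_orthogonal_singleton_iff_inner_right, real_inner_comm]
    exact hxu
  let M : Matrix (Fin (d + 1)) (Fin (d + 1)) ℝ :=
    LinearMap.toMatrix (EuclideanSpace.basisFun (Fin (d + 1)) ℝ).toBasis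
      (EuclideanSpace.basisFun (Fin (d + 1)) ℝ).toBasis (g.toLinearEquiv : E d →ₗ[ℝ] E d)
  have hM : M ∈ Matrix.specialOrthogonalGroup (Fin (d + 1)) ℝ := by
    rw [Matrix.mem_specialOrthogonalGroup_iff]
    refine ⟨g.toMatrix_mem_unitaryGroup _ _, ?_⟩
    rw [LinearMap.det_toMatrix]
    exact hdet
  have hMg : Matrix.toEuclideanLin M = (g.toLinearEquiv : E d →ₗ[ℝ] E d) := by
    rw [Matrix.toEuclideanLin_eq_toLin_orthonormal]
    exact Matrix.toLin_toMatrix _ _ _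
  refine ⟨⟨M, hM⟩, Subtype.ext ?_⟩
  rw [coe_smul_sph, hMg]
  exact hgo

theorem rotTo_smul (hd : 1 ≤ d) (o x : Sph d) : rotTo o x • o = x :=
  Function.invFun_eq (f := fun φ : SO d => φ • o) (exists_smul_eq_sph hd o x)

instance (o : Sph d) : IsProbabilityMeasure (stabHaar o) :=
  ⟨by
    have h := Measure.haarMeasure_self (G := Stab o) (K₀ := ⊤)
    simpa [stabHaar] using h⟩

theorem measurable_rotTo_mul (o x : Sph d) :
    Measurable fun ψ : Stab o => rotTo o x * (ψ : SO d) :=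
  (continuous_const.mul continuous_subtype_val).measurable

/-- The kernel `κ(x, ·)` is a probability measure on the rotations that take `o` to `x`, so an
event which is decided by the value `φ • o` has probability zero or one. -/
theorem kappa_setOf (hd : 1 ≤ d) (o x : Sph d) (p : SO d → Prop) (q : Prop) [Decidable q]
    (h : ∀ φ : SO d, φ • o = x → (p φ ↔ q)) : kappa o x {φ | p φ} = if q then 1 else 0 := by
  have hprob : IsProbabilityMeasure (kappa o x) :=
    Measure.isProbabilityMeasure_map (measurable_rotTo_mul o x).aemeasurable
  have hmem : ∀ᵐ φ ∂kappa o x, φ • o = x := by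
    have hm : MeasurableSet {φ : SO d | φ • o = x} :=
      (isClosed_singleton.preimage (continuous_smul_const o)).measurableSet
    rw [kappa, ae_map_iff (measurable_rotTo_mul o x).aemeasurable hm]
    refine Filter.Eventually.of_forall fun ψ => ?_
    rw [mul_smul, MulAction.mem_stabilizer_iff.1 ψ.2, rotTo_smul hd]
  have hae : ({φ | p φ} : Set (SO d)) =ᵐ[kappa o x] {_φ | q} := by
    filter_upwards [hmem] with φ hφ
    exact propext (h φ hφ)
  rw [measure_congr hae]
  by_cases hq : q <;> simp [hq]

end Rotation

/-! ### Inradius and circumradius of a Voronoi cell -/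

section Radii

variable {d : ℕ}

theorem capBall_smul (φ : SO d) (o : Sph d) (r : ℝ) : capBall (φ • o) r = φ • capBall o r := by
  ext y
  rw [mem_smul_set_iff_inv_smul_mem, mem_capBall, mem_capBall, ← geodist_smul_smul φ o,
    smul_inv_smul]

theorem inrad_inv_smul (φ : SO d) (o : Sph d) (K : Set (Sph d)) :
    inrad o (φ⁻¹ • K) = inrad (φ • o) K := by
  simp only [inrad, capBall_smul, subset_smul_set_iff, inv_inv]

theorem circumrad_inv_smul (φ : SO d) (o : Sph d) (K : Set (Sph d)) :
    circumrad o (φ⁻¹ • K) = circumrad (φ • o) K := by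
  simp only [circumrad, capBall_smul, smul_set_subset_iff_subset_inv_smul_set, inv_inv]

theorem isClosed_voronoiCell (x : Sph d) (A : Finset (Sph d)) : IsClosed (voronoiCell x A) := by
  simp only [voronoiCell, ofPred_forall]
  exact isClosed_iInter fun z => isClosed_iInter fun _ =>
    isClosed_le (continuous_geodist continuous_id continuous_const)
      (continuous_geodist continuous_id continuous_const)

theorem self_mem_voronoiCell (x : Sph d) (A : Finset (Sph d)) : x ∈ voronoiCell x A :=
  fun z _ => by rw [geodist_self]; exact geodist_nonneg x z

theorem bddAbove_inrad (o : Sph d) (K : Set (Sph d)) :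
    BddAbove {r : ℝ | 0 ≤ r ∧ r ≤ Real.pi ∧ capBall o r ⊆ K} := ⟨Real.pi, fun _ hr => hr.2.1⟩

/-- A closed ball of radius `r` around the nucleus lies in the cell if the other points have
distance at least `2r` from the nucleus. -/
theorem capBall_subset_voronoiCell {x : Sph d} {A : Finset (Sph d)} {r : ℝ}
    (h : ∀ z ∈ A, z ≠ x → 2 * r ≤ geodist x z) : capBall x r ⊆ voronoiCell x A := by
  intro y hy z hz
  by_cases hzx : z = x
  · rw [hzx]
  · have h1 := h z hz hzx
    have h2 := geodist_triangle x y z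
    rw [mem_capBall] at hy
    rw [geodist_comm y x]
    linarith

theorem le_inrad_voronoiCell {x : Sph d} {A : Finset (Sph d)} {r : ℝ} (h0 : 0 ≤ r)
    (hpi : r ≤ Real.pi) (h : ∀ z ∈ A, z ≠ x → 2 * r ≤ geodist x z) :
    r ≤ inrad x (voronoiCell x A) :=
  le_csSup (bddAbove_inrad _ _) ⟨h0, hpi, capBall_subset_voronoiCell h⟩

theorem two_mul_le_geodist_of_le_inrad (hd : 1 ≤ d) {x : Sph d} {A : Finset (Sph d)} {a : ℝ}
    (h : a ≤ inrad x (voronoiCell x A)) {z : Sph d} (hz : z ∈ A) (hzx : z ≠ x) :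
    2 * a ≤ geodist x z := by
  by_contra! hlt
  have ht := geodist_pos hzx.symm
  -- a point `w` between `x` and `z` that is nearer to `z` and lies in an inscribed ball
  obtain ⟨s, hs1, hs2⟩ := _root_.exists_between
    (lt_min (by linarith : geodist x z / 2 < a) (half_lt_self ht))
  have hs : s < inrad x (voronoiCell x A) := (hs2.trans_le (min_le_left _ _)).trans_le h
  have hne : {r : ℝ | 0 ≤ r ∧ r ≤ Real.pi ∧ capBall x r ⊆ voronoiCell x A}.Nonempty :=
    ⟨0, le_rfl, Real.pi_pos.le, fun y hy => by
      by_contra hy'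
      have : x ≠ y := fun hxy => hy' (hxy ▸ self_mem_voronoiCell x A)
      exact absurd (geodist_pos this) (not_lt.2 hy)⟩
  obtain ⟨r, hr, hsr⟩ := exists_lt_of_lt_csSup hne hs
  obtain ⟨w, hw1, hw2⟩ := exists_between hd x z (by linarith : 0 ≤ s)
    (hs2.le.trans (min_le_right _ _))
  have h1 := hr.2.2 (mem_capBall.2 (hw1.le.trans hsr.le)) z hz
  rw [geodist_comm w x] at h1
  linarith

theorem circumrad_le {o : Sph d} {K : Set (Sph d)} {r : ℝ} (h0 : 0 ≤ r) (h : K ⊆ capBall o r) :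
    circumrad o K ≤ r :=
  csInf_le ⟨0, fun _ hr => hr.1⟩ ⟨h0, h⟩

/-- The circumradius of a Voronoi cell is attained. -/
theorem exists_geodist_eq_circumrad (x : Sph d) (A : Finset (Sph d)) :
    ∃ y ∈ voronoiCell x A, circumrad x (voronoiCell x A) ≤ geodist x y := by
  obtain ⟨y, hy, hmax⟩ := (isClosed_voronoiCell x A).isCompact.exists_isMaxOn
    ⟨x, self_mem_voronoiCell x A⟩
    (continuous_geodist (continuous_const (y := x)) continuous_id).continuousOn
  exact ⟨y, hy, circumrad_le (geodist_nonneg _ _) fun z hz => hmax hz⟩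

/-- If the cell of `x` has inradius at least `a` and its circumradius exceeds the inradius by at
least `ε`, then `ε ≤ π - 2a`, and the points of the process avoid the open ball of radius `a + ε`
around some point at distance `a + ε` from `x`. -/
theorem exists_empty_ball_of_le_circumrad_sub_inrad (hd : 1 ≤ d) {x : Sph d}
    {A : Finset (Sph d)} {a ε : ℝ} (ha : 0 ≤ a) (hε : 0 < ε)
    (hr : a ≤ inrad x (voronoiCell x A))
    (hR : ε ≤ circumrad x (voronoiCell x A) - inrad x (voronoiCell x A)) :
    ε ≤ Real.pi - 2 * a ∧
      ∃ y : Sph d, geodist x y = a + ε ∧ ∀ z ∈ A, a + ε ≤ geodist y z := by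
  obtain ⟨y, hy, hyR⟩ := exists_geodist_eq_circumrad x A
  refine ⟨?_, ?_⟩
  · by_cases hne : ∃ z ∈ A, z ≠ x
    · classical
      obtain ⟨z₀, hz₀, hz₀x⟩ := hne
      obtain ⟨z, hz, hmin⟩ := (A.erase x).exists_min_image (geodist x)
        ⟨z₀, Finset.mem_erase.2 ⟨hz₀x, hz₀⟩⟩
      have hzA := Finset.mem_of_mem_erase hz
      have hzx := Finset.ne_of_mem_erase hz
      have h1 : geodist x z / 2 ≤ inrad x (voronoiCell x A) :=
        le_inrad_voronoiCell (by linarith [geodist_nonneg x z])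
          (by linarith [geodist_le_pi x z, Real.pi_pos])
          fun z' hz' hne' => by linarith [hmin z' (Finset.mem_erase.2 ⟨hne', hz'⟩)]
      have h2 := two_mul_le_geodist_of_le_inrad hd hr hzA hzx
      have h3 := hy z hzA
      have h4 := geodist_perimeter x y z
      rw [geodist_comm y x] at h3
      linarith
    -- a single point has the whole sphere as its cell
    · push Not at hne
      have h1 : Real.pi ≤ inrad x (voronoiCell x A) :=
        le_inrad_voronoiCell Real.pi_pos.le le_rfl fun z hz hzx => absurd (hne z hz) hzx
      linarith [geodist_le_pi x y]
  · have hy' : a + ε ≤ geodist x y := by linarith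
    -- the open ball around `y` up to `x` is empty, hence also the smaller one around `w`
    obtain ⟨w, hw1, hw2⟩ := exists_between hd x y (by linarith : 0 ≤ a + ε) hy'
    refine ⟨w, hw1, fun z hz => ?_⟩
    have h1 := hy z hz
    have h2 := geodist_triangle y w z
    rw [geodist_comm y x] at h1
    rw [geodist_comm y w] at h2
    linarith

end Radii

/-! ### Polar coordinates on the sphere -/

section Polar

/-- A set that is invariant under multiplication with positive scalars. -/
def IsCone {V : Type*} [SMul ℝ V] (C : Set V) : Prop :=
  ∀ c : ℝ, 0 < c → ∀ v : V, c • v ∈ C ↔ v ∈ C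

/-- The surface measure of the trace of a cone on the unit sphere, in terms of Lebesgue measure. -/
theorem toSphere_cone {V : Type*} [NormedAddCommGroup V] [InnerProductSpace ℝ V]
    [FiniteDimensional ℝ V] [MeasurableSpace V] [BorelSpace V] {C : Set V}
    (hC : IsCone C) (hm : MeasurableSet C) :
    (volume : Measure V).toSphere {p | (p : V) ∈ C} =
      Module.finrank ℝ V * volume (C ∩ Metric.ball 0 1) := by
  have hS : MeasurableSet {p : Metric.sphere (0 : V) 1 | (p : V) ∈ C} := measurable_subtype_coe hm
  rw [Measure.toSphere_apply' _ hS]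
  rcases subsingleton_or_nontrivial V with hV | hV
  · have hz : Module.finrank ℝ V = 0 := Module.finrank_zero_of_subsingleton
    rw [hz]
    simp
  congr 1
  have h0 : volume ((C ∩ Metric.ball 0 1) \ {0}) = volume (C ∩ Metric.ball 0 1) :=
    measure_sdiff_null (measure_singleton _)
  rw [← h0]
  congr 1
  ext v
  simp only [mem_smul, mem_image, mem_sdiff, mem_inter_iff, mem_singleton_iff,
    mem_ball_zero_iff]
  constructor
  · rintro ⟨c, ⟨hc0, hc1⟩, _, ⟨p, hp, rfl⟩, rfl⟩
    have hn : ‖(p : V)‖ = 1 := mem_sphere_zero_iff_norm.1 p.2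
    refine ⟨⟨(hC c hc0 _).2 hp, ?_⟩, ?_⟩
    · rw [norm_smul, hn, mul_one, Real.norm_of_nonneg hc0.le]
      exact hc1
    · rw [← norm_eq_zero, norm_smul, hn, mul_one, norm_eq_zero]
      exact hc0.ne'
  · rintro ⟨⟨hvC, hv1⟩, hv0⟩
    have hn : 0 < ‖v‖ := norm_pos_iff.2 hv0
    refine ⟨‖v‖, ⟨hn, hv1⟩, _, ⟨⟨‖v‖⁻¹ • v, ?_⟩, ?_, rfl⟩, ?_⟩
    · rw [mem_sphere_zero_iff_norm, norm_smul, norm_inv, norm_norm, inv_mul_cancel₀ hn.ne']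
    · exact (hC _ (inv_pos.2 hn) v).2 hvC
    · exact smul_inv_smul₀ hn.ne' v

/-- Integration of a radial function over a cone in polar coordinates. -/
theorem setLIntegral_cone_norm {V : Type*} [NormedAddCommGroup V] [InnerProductSpace ℝ V]
    [FiniteDimensional ℝ V] [MeasurableSpace V] [BorelSpace V] [Nontrivial V] {C : Set V}
    (hC : IsCone C) (hm : MeasurableSet C) {h : ℝ → ℝ≥0∞} (hh : Measurable h) :
    ∫⁻ v in C, h ‖v‖ = (volume : Measure V).toSphere {p | (p : V) ∈ C} *
      ∫⁻ r in Ioi (0 : ℝ), ENNReal.ofReal (r ^ (Module.finrank ℝ V - 1)) * h r := by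
  have hS : MeasurableSet {p : Metric.sphere (0 : V) 1 | (p : V) ∈ C} := measurable_subtype_coe hm
  have h0 : ∫⁻ v in C, h ‖v‖ = ∫⁻ v : ({(0 : V)}ᶜ : Set V), C.indicator (fun v => h ‖v‖) (v : V)
      ∂(volume : Measure V).comap Subtype.val := by
    rw [lintegral_subtype_comap (measurableSet_singleton _).compl, restrict_compl_singleton,
      lintegral_indicator hm]
  let G : Metric.sphere (0 : V) 1 × Ioi (0 : ℝ) → ℝ≥0∞ := fun q =>
    {p : Metric.sphere (0 : V) 1 | (p : V) ∈ C}.indicator 1 q.1 * h q.2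
  have key : ∀ v : ({(0 : V)}ᶜ : Set V), C.indicator (fun v => h ‖v‖) (v : V) =
      G (homeomorphUnitSphereProd V v) := by
    intro v
    change _ = {p : Metric.sphere (0 : V) 1 | (p : V) ∈ C}.indicator 1
      (homeomorphUnitSphereProd V v).1 * h (homeomorphUnitSphereProd V v).2
    have hv : 0 < ‖(v : V)‖ := norm_pos_iff.2 v.2
    have hiff := hC _ (inv_pos.2 hv) (v : V)
    simp only [homeomorphUnitSphereProd_apply_snd_coe]
    by_cases hvC : (v : V) ∈ C
    · rw [indicator_of_mem hvC, indicator_of_mem, Pi.one_apply, one_mul]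
      simpa using hiff.2 hvC
    · rw [indicator_of_notMem hvC, indicator_of_notMem, zero_mul]
      simpa using fun h' => hvC (hiff.1 h')
  rw [h0, lintegral_congr key]
  refine ((Measure.measurePreserving_homeomorphUnitSphereProd
    (volume : Measure V)).lintegral_comp_emb (Homeomorph.measurableEmbedding _) G).trans ?_
  have hh' : Measurable fun r : Ioi (0 : ℝ) => h r := hh.comp measurable_subtype_coe
  refine (lintegral_prod_mul (measurable_one.indicator hS).aemeasurable hh'.aemeasurable).trans ?_
  rw [lintegral_indicator_one hS]
  congr 1
  rw [Measure.volumeIoiPow, lintegral_withDensity_eq_lintegral_mul _ (by fun_prop) hh',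
    ← lintegral_subtype_comap measurableSet_Ioi]
  rfl

/-- The integral of `ρ ^ k` over a sector of the upper half of the unit disc. -/
theorem lintegral_sector (k : ℕ) {T : Set ℝ} (hT : MeasurableSet T) :
    ∫⁻ ρ in Ioi (0 : ℝ), ENNReal.ofReal (ρ ^ k) * volume {s : ℝ | s ^ 2 + ρ ^ 2 < 1 ∧
        Real.arccos (s / √(s ^ 2 + ρ ^ 2)) ∈ T} =
      ENNReal.ofReal ((k + 2 : ℝ)⁻¹) *
        ∫⁻ t in T ∩ Ioo 0 Real.pi, ENNReal.ofReal (Real.sin t ^ k) := by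
  set S : Set (ℝ × ℝ) := {q | q.1 ^ 2 + q.2 ^ 2 < 1 ∧
    Real.arccos (q.1 / √(q.1 ^ 2 + q.2 ^ 2)) ∈ T ∧ 0 < q.2} with hSdef
  have hS : MeasurableSet S := by
    refine MeasurableSet.inter ?_ (MeasurableSet.inter ?_ ?_)
    · exact measurableSet_lt (by fun_prop : Measurable fun q : ℝ × ℝ => q.1 ^ 2 + q.2 ^ 2)
        measurable_const
    · have h : Measurable fun q : ℝ × ℝ => Real.arccos (q.1 / √(q.1 ^ 2 + q.2 ^ 2)) :=
        Real.measurable_arccos.comp (by fun_prop)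
      exact h hT
    · exact measurableSet_lt measurable_const measurable_snd
  have h1 : ∫⁻ q : ℝ × ℝ, S.indicator (fun q => ENNReal.ofReal (q.2 ^ k)) q =
      ∫⁻ ρ in Ioi (0 : ℝ), ENNReal.ofReal (ρ ^ k) * volume {s : ℝ | s ^ 2 + ρ ^ 2 < 1 ∧
        Real.arccos (s / √(s ^ 2 + ρ ^ 2)) ∈ T} := by
    have hm : Measurable (S.indicator (fun q => ENNReal.ofReal (q.2 ^ k))) :=
      (by fun_prop : Measurable fun q : ℝ × ℝ => ENNReal.ofReal (q.2 ^ k)).indicator hS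
    rw [Measure.volume_eq_prod, lintegral_prod_symm' _ hm,
      ← lintegral_indicator measurableSet_Ioi]
    refine lintegral_congr fun ρ => ?_
    by_cases hρ : 0 < ρ
    · rw [indicator_of_mem (mem_Ioi.2 hρ)]
      have hm' : MeasurableSet {s : ℝ | s ^ 2 + ρ ^ 2 < 1 ∧
          Real.arccos (s / √(s ^ 2 + ρ ^ 2)) ∈ T} :=
        MeasurableSet.inter
          (measurableSet_lt (by fun_prop : Measurable fun s : ℝ => s ^ 2 + ρ ^ 2) measurable_const)
          ((Real.measurable_arccos.comp
            (by fun_prop : Measurable fun s : ℝ => s / √(s ^ 2 + ρ ^ 2))) hT)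
      rw [← setLIntegral_const, ← lintegral_indicator hm']
      refine lintegral_congr fun s => ?_
      have : (s, ρ) ∈ S ↔ s ∈ {s : ℝ | s ^ 2 + ρ ^ 2 < 1 ∧
          Real.arccos (s / √(s ^ 2 + ρ ^ 2)) ∈ T} := by
        simp only [hSdef, mem_ofPred_eq, hρ, and_true]
      by_cases hs : (s, ρ) ∈ S
      · rw [indicator_of_mem hs, indicator_of_mem (this.1 hs)]
      · rw [indicator_of_notMem hs, indicator_of_notMem (fun h => hs (this.2 h))]
    · rw [indicator_of_notMem (by simpa using hρ)]
      have : ∀ s, (s, ρ) ∉ S := fun s hs => hρ hs.2.2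
      simp only [indicator_of_notMem (this _), lintegral_zero]
  rw [← h1, ← lintegral_comp_polarCoord_symm]
  have htgt : polarCoord.target = Ioi (0 : ℝ) ×ˢ Ioo (-Real.pi) Real.pi := rfl
  have h2 : ∀ q ∈ polarCoord.target, ENNReal.ofReal q.1 •
      S.indicator (fun q => ENNReal.ofReal (q.2 ^ k)) (polarCoord.symm q) =
      (Iio (1 : ℝ)).indicator (fun r => ENNReal.ofReal (r ^ (k + 1))) q.1 *
        (T ∩ Ioo 0 Real.pi).indicator (fun t => ENNReal.ofReal (Real.sin t ^ k)) q.2 := by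
    rintro ⟨r, t⟩ ⟨hr, ht⟩
    simp only [mem_Ioi, mem_Ioo] at hr ht
    have hnorm : (r * Real.cos t) ^ 2 + (r * Real.sin t) ^ 2 = r ^ 2 := by
      nlinarith [Real.sin_sq_add_cos_sq t]
    have hmem : polarCoord.symm (r, t) ∈ S ↔ r < 1 ∧ (t ∈ T ∧ 0 < t ∧ t < Real.pi) := by
      simp only [polarCoord_symm_apply, hSdef, mem_ofPred_eq, hnorm, Real.sqrt_sq hr.le,
        mul_div_cancel_left₀ _ hr.ne', mul_pos_iff_of_pos_left hr]
      have hr1 : r ^ 2 < 1 ↔ r < 1 := by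
        rw [sq_lt_one_iff₀ hr.le]
      rw [hr1]
      have hs : 0 < Real.sin t ↔ 0 < t := by
        refine ⟨fun h => ?_, fun h => Real.sin_pos_of_pos_of_lt_pi h ht.2⟩
        by_contra! h'
        have := Real.sin_nonpos_of_nonpos_of_neg_pi_le h' ht.1.le
        linarith
      rw [hs]
      refine and_congr_right fun _ => ?_
      constructor
      · rintro ⟨h1, h2⟩
        rw [Real.arccos_cos h2.le ht.2.le] at h1
        exact ⟨h1, h2, ht.2⟩
      · rintro ⟨h1, h2, h3⟩
        rw [Real.arccos_cos h2.le ht.2.le]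
        exact ⟨h1, h2⟩
    by_cases h : polarCoord.symm (r, t) ∈ S
    · have h' := hmem.1 h
      rw [indicator_of_mem h, indicator_of_mem (mem_Iio.2 h'.1),
        indicator_of_mem (show t ∈ T ∩ Ioo 0 Real.pi from h'.2), polarCoord_symm_apply,
        smul_eq_mul, ← ENNReal.ofReal_mul hr.le, ← ENNReal.ofReal_mul (by positivity)]
      congr 1
      ring
    · rw [indicator_of_notMem h, smul_zero]
      by_cases hr1 : r < 1
      · rw [indicator_of_notMem (s := T ∩ Ioo 0 Real.pi) (fun h' => h (hmem.2 ⟨hr1, h'⟩)), mul_zero]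
      · rw [indicator_of_notMem (s := Iio (1 : ℝ)) (by simpa using hr1), zero_mul]
  rw [setLIntegral_congr_fun polarCoord.open_target.measurableSet h2, htgt,
    Measure.volume_eq_prod, ← Measure.prod_restrict]
  have hTm : MeasurableSet (T ∩ Ioo 0 Real.pi) := hT.inter measurableSet_Ioo
  rw [lintegral_prod_mul]
  · congr 1
    · rw [lintegral_indicator measurableSet_Iio, Measure.restrict_restrict measurableSet_Iio,
        Iio_inter_Ioi, ← ofReal_integral_eq_lintegral_ofReal, ← integral_Ioc_eq_integral_Ioo,
        ← intervalIntegral.integral_of_le zero_le_one, integral_pow]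
      · congr 1
        push_cast
        rw [one_pow, zero_pow (by omega), sub_zero, one_div]
        congr 1
        ring
      · exact ((continuous_pow (k + 1)).integrableOn_Icc).mono_set Ioo_subset_Icc_self
      · filter_upwards [ae_restrict_mem measurableSet_Ioo] with r hr
        exact pow_nonneg hr.1.le _
    · rw [lintegral_indicator hTm, Measure.restrict_restrict hTm]
      congr 2
      ext t
      simp only [mem_inter_iff, mem_Ioo]
      constructor
      · rintro ⟨⟨h1, h2⟩, _⟩
        exact ⟨h1, h2⟩
      · rintro ⟨h1, h2⟩
        exact ⟨⟨h1, h2⟩, by linarith [Real.pi_pos], h2.2⟩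
  · exact ((by fun_prop : Measurable fun r : ℝ => ENNReal.ofReal (r ^ (k + 1))).indicator
      measurableSet_Iio).aemeasurable
  · exact ((by fun_prop : Measurable fun t : ℝ => ENNReal.ofReal (Real.sin t ^ k)).indicator
      hTm).aemeasurable

end Polar

section PolarSphere

variable {d : ℕ}

/-- The last `d` coordinates of a vector of `ℝ^(d+1)`. -/
def tail (v : E d) : EuclideanSpace ℝ (Fin d) := WithLp.toLp 2 fun i => v i.succ

theorem measurable_tail : Measurable (tail : E d → EuclideanSpace ℝ (Fin d)) := by
  unfold tail
  fun_prop

theorem tail_smul (c : ℝ) (v : E d) : tail (c • v) = c • tail v := rfl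

theorem norm_sq_eq_head_tail (v : E d) : ‖v‖ ^ 2 = v 0 ^ 2 + ‖tail v‖ ^ 2 := by
  rw [EuclideanSpace.real_norm_sq_eq, EuclideanSpace.real_norm_sq_eq, Fin.sum_univ_succ]
  rfl

theorem inner_eq_head_tail (v w : E d) :
    inner ℝ v w = v 0 * w 0 + inner ℝ (tail v) (tail w) := by
  simp only [PiLp.inner_apply, Fin.sum_univ_succ, tail, RCLike.inner_apply, conj_trivial]
  ring

theorem measurePreserving_head_tail :
    MeasurePreserving (fun v : E d => (v 0, tail v)) volume (volume.prod volume) := by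
  have h1 := (PiLp.volume_preserving_ofLp (Fin (d + 1)))
  have h2 := volume_preserving_piFinSuccAbove (fun _ : Fin (d + 1) => ℝ) 0
  have h3 := (MeasurePreserving.id (volume : Measure ℝ)).prod (PiLp.volume_preserving_toLp (Fin d))
  exact h3.comp (h2.comp h1)

/-- Polar coordinates on the sphere: a point is described by its distance `t` from the point which
the isometry `g` maps to the first basis vector, and by the direction of the remaining coordinates.
The surface measure has the density `sin ^ (d - 1)` with respect to `t`. -/
theorem sigma_polar (hd : 1 ≤ d) (g : E d ≃ₗᵢ[ℝ] E d) {T : Set ℝ} (hT : MeasurableSet T)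
    {D : Set (EuclideanSpace ℝ (Fin d))} (hD : IsCone D) (hDm : MeasurableSet D) :
    sigma d {p | Real.arccos (g (p : E d) 0) ∈ T ∧ tail (g (p : E d)) ∈ D} =
      (volume : Measure (EuclideanSpace ℝ (Fin d))).toSphere
          {q | (q : EuclideanSpace ℝ (Fin d)) ∈ D} *
        ∫⁻ t in T ∩ Ioo 0 Real.pi, ENNReal.ofReal (Real.sin t ^ (d - 1)) := by
  have : Nonempty (Fin d) := ⟨⟨0, hd⟩⟩
  set C : Set (E d) := {v | Real.arccos (g v 0 / ‖v‖) ∈ T ∧ tail (g v) ∈ D} with hCdef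
  have hg0 : Measurable fun v : E d => g v 0 := by
    have : Measurable g := g.continuous.measurable
    fun_prop
  have hCm : MeasurableSet C := by
    have h1 : Measurable fun v : E d => Real.arccos (g v 0 / ‖v‖) :=
      Real.measurable_arccos.comp (hg0.div measurable_norm)
    exact (h1 hT).inter ((measurable_tail.comp g.continuous.measurable) hDm)
  have hC : IsCone C := by
    intro c hc v
    simp only [hCdef, mem_ofPred_eq, map_smul, tail_smul, norm_smul, Real.norm_of_nonneg hc.le,
      PiLp.smul_apply, smul_eq_mul, mul_div_mul_left _ _ hc.ne', hD c hc]
  have h1 : {p : Sph d | Real.arccos (g (p : E d) 0) ∈ T ∧ tail (g (p : E d)) ∈ D} =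
      {p : Sph d | (p : E d) ∈ C} := by
    ext p
    simp only [hCdef, mem_ofPred_eq, norm_coe_sph, div_one]
  rw [h1, sigma, toSphere_cone hC hCm]
  -- membership in the cone depends on the first coordinate and the other ones, `q.1` and `q.2`
  set S : Set (ℝ × EuclideanSpace ℝ (Fin d)) := {q | q.2 ∈ D ∧ q.1 ^ 2 + ‖q.2‖ ^ 2 < 1 ∧
    Real.arccos (q.1 / √(q.1 ^ 2 + ‖q.2‖ ^ 2)) ∈ T} with hSdef
  have hS : MeasurableSet S := by
    refine (measurable_snd hDm).inter (MeasurableSet.inter ?_ ?_)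
    · exact measurableSet_lt
        (by fun_prop : Measurable fun q : ℝ × EuclideanSpace ℝ (Fin d) => q.1 ^ 2 + ‖q.2‖ ^ 2)
        measurable_const
    · have h : Measurable fun q : ℝ × EuclideanSpace ℝ (Fin d) =>
          Real.arccos (q.1 / √(q.1 ^ 2 + ‖q.2‖ ^ 2)) :=
        Real.measurable_arccos.comp (by fun_prop)
      exact h hT
  have h2 : C ∩ Metric.ball 0 1 = (fun v => (g v 0, tail (g v))) ⁻¹' S := by
    ext v
    have hn : g v 0 ^ 2 + ‖tail (g v)‖ ^ 2 = ‖v‖ ^ 2 := by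
      rw [← norm_sq_eq_head_tail, g.norm_map]
    simp only [hCdef, hSdef, mem_inter_iff, mem_preimage, mem_ofPred_eq, mem_ball_zero_iff, hn,
      Real.sqrt_sq (norm_nonneg _), sq_lt_one_iff₀ (norm_nonneg _)]
    tauto
  have h3 : volume (C ∩ Metric.ball 0 1) = (volume.prod volume) S := by
    rw [h2]
    exact (measurePreserving_head_tail.comp g.measurePreserving).measure_preimage
      hS.nullMeasurableSet
  set h : ℝ → ℝ≥0∞ := fun ρ => volume {s : ℝ | s ^ 2 + ρ ^ 2 < 1 ∧
    Real.arccos (s / √(s ^ 2 + ρ ^ 2)) ∈ T} with hhdef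
  have hh : Measurable h := by
    have hS' : MeasurableSet {q : ℝ × ℝ | q.2 ^ 2 + q.1 ^ 2 < 1 ∧
        Real.arccos (q.2 / √(q.2 ^ 2 + q.1 ^ 2)) ∈ T} := by
      refine MeasurableSet.inter ?_ ?_
      · exact measurableSet_lt
          (by fun_prop : Measurable fun q : ℝ × ℝ => q.2 ^ 2 + q.1 ^ 2) measurable_const
      · have h : Measurable fun q : ℝ × ℝ => Real.arccos (q.2 / √(q.2 ^ 2 + q.1 ^ 2)) :=
          Real.measurable_arccos.comp (by fun_prop)
        exact h hT
    exact measurable_measure_prodMk_left hS'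
  have h4 : (volume.prod volume) S = ∫⁻ w in D, h ‖w‖ := by
    rw [Measure.prod_apply_symm hS, ← lintegral_indicator hDm]
    refine lintegral_congr fun w => ?_
    by_cases hw : w ∈ D
    · rw [indicator_of_mem hw]
      congr 1
      ext s
      simp only [hSdef, mem_preimage, mem_ofPred_eq, hw, true_and]
    · rw [indicator_of_notMem hw]
      have : (fun s : ℝ => (s, w)) ⁻¹' S = ∅ := by
        ext s
        simp only [hSdef, mem_preimage, mem_ofPred_eq, hw, false_and, mem_empty_iff_false]
      rw [this, measure_empty]
  rw [h3, h4, setLIntegral_cone_norm hD hDm hh, finrank_euclideanSpace_fin,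
    finrank_euclideanSpace_fin, lintegral_sector (d - 1) hT, mul_left_comm, ← mul_assoc,
    ← mul_assoc]
  have h5 : ((d + 1 : ℕ) : ℝ≥0∞) * ENNReal.ofReal (((d - 1 : ℕ) : ℝ) + 2)⁻¹ = 1 := by
    rw [← ENNReal.ofReal_natCast, ← ENNReal.ofReal_mul (by positivity), Nat.cast_sub hd]
    push_cast
    rw [show (d : ℝ) - 1 + 2 = d + 1 by ring, mul_inv_cancel₀ (by positivity), ENNReal.ofReal_one]
  rw [mul_assoc _ (((d + 1 : ℕ) : ℝ≥0∞)), h5, mul_one]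

/-- An isometry that maps `x` to the first basis vector. -/
theorem exists_isometry_head (x : Sph d) :
    ∃ g : E d ≃ₗᵢ[ℝ] E d, ∀ v : E d, g v 0 = inner ℝ (x : E d) v := by
  have hv : Orthonormal ℝ (({0} : Set (Fin (d + 1))).domRestrict fun _ => (x : E d)) := by
    constructor
    · intro i
      exact norm_coe_sph x
    · intro i j hij
      exact absurd (Subsingleton.elim i j) hij
  obtain ⟨b, hb⟩ := hv.exists_orthonormalBasis_extension_of_card_eq
    (by rw [finrank_euclideanSpace_fin, Fintype.card_fin])
  refine ⟨b.repr, fun v => ?_⟩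
  rw [b.repr_apply_apply, hb 0 rfl]

/-- The law of the distance from a fixed point; it does not depend on this point. -/
theorem sigma_geodist_mem (hd : 1 ≤ d) (x : Sph d) {T : Set ℝ} (hT : MeasurableSet T) :
    sigma d {p | geodist x p ∈ T} = ENNReal.ofReal (omega d) *
        ∫⁻ t in T ∩ Ioo 0 Real.pi, ENNReal.ofReal (Real.sin t ^ (d - 1)) := by
  obtain ⟨g, hg⟩ := exists_isometry_head x
  have h := sigma_polar hd g hT (D := univ) (fun _ _ _ => Iff.rfl) MeasurableSet.univ
  have e : {p : Sph d | geodist x p ∈ T} =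
      {p : Sph d | Real.arccos (g (p : E d) 0) ∈ T ∧ tail (g (p : E d)) ∈ univ} := by
    ext p
    simp only [mem_ofPred_eq, hg, geodist_eq_arccos, mem_univ, and_true]
  have e' : {q : Metric.sphere (0 : EuclideanSpace ℝ (Fin d)) 1 |
      (q : EuclideanSpace ℝ (Fin d)) ∈ univ} = univ := by
    ext; simp
  rw [e, h, e', omega, ofReal_measureReal]

instance : IsFiniteMeasure (sigma d) := inferInstanceAs (IsFiniteMeasure (Measure.toSphere _))

theorem sigma_real_univ : (sigma d).real univ = omega (d + 1) := rfl

theorem omega_nonneg (n : ℕ) : 0 ≤ omega n := measureReal_nonneg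

theorem omega_pos {n : ℕ} (hn : 1 ≤ n) : 0 < omega n := by
  have : Nonempty (Fin n) := ⟨⟨0, hn⟩⟩
  rw [omega, Measure.toSphere_real_apply_univ, finrank_euclideanSpace_fin]
  have h : 0 < (volume : Measure (EuclideanSpace ℝ (Fin n))).real (Metric.ball 0 1) :=
    ENNReal.toReal_pos (Metric.measure_ball_pos _ _ one_pos).ne' measure_ball_lt_top.ne
  have : (0 : ℝ) < n := by exact_mod_cast hn
  positivity

/-- The measure of a zone is at most `ω_d` times its width. -/
theorem sigma_geodist_mem_le (hd : 1 ≤ d) (x : Sph d) {r s : ℝ} (hrs : r ≤ s) :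
    (sigma d).real {p | geodist x p ∈ Icc r s} ≤ omega d * (s - r) := by
  refine ENNReal.toReal_le_of_le_ofReal
    (mul_nonneg (omega_nonneg d) (sub_nonneg.2 hrs)) ?_
  rw [sigma_geodist_mem hd x measurableSet_Icc, ENNReal.ofReal_mul (omega_nonneg d)]
  gcongr
  calc ∫⁻ t in Icc r s ∩ Ioo 0 Real.pi, ENNReal.ofReal (Real.sin t ^ (d - 1))
      ≤ ∫⁻ _ in Icc r s ∩ Ioo 0 Real.pi, 1 := by
        refine setLIntegral_mono measurable_const fun t ht => ?_
        rw [ENNReal.ofReal_le_one]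
        exact pow_le_one₀ (Real.sin_pos_of_mem_Ioo ht.2).le (Real.sin_le_one t)
    _ = volume (Icc r s ∩ Ioo 0 Real.pi) := setLIntegral_one _
    _ ≤ volume (Icc r s) := measure_mono inter_subset_left
    _ = ENNReal.ofReal (s - r) := Real.volume_Icc

theorem sigma_real_capBall_eq (hd : 1 ≤ d) (x y : Sph d) (r : ℝ) :
    (sigma d).real (capBall x r) = (sigma d).real (capBall y r) := by
  have h := fun z : Sph d => sigma_geodist_mem hd z (measurableSet_Iic (a := r))
  exact congrArg ENNReal.toReal ((h x).trans (h y).symm)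

theorem sigma_real_capBall_le (hd : 1 ≤ d) (x : Sph d) {r : ℝ} (hr : 0 ≤ r) :
    (sigma d).real (capBall x r) ≤ omega d * r := by
  have h := sigma_geodist_mem_le hd x hr
  rw [sub_zero] at h
  exact (measureReal_mono (s₂ := {p | geodist x p ∈ Icc 0 r})
    fun p hp => ⟨geodist_nonneg x p, hp⟩).trans h

theorem sigma_real_capBall_le_add (hd : 1 ≤ d) (x : Sph d) {r s : ℝ} (hrs : r ≤ s) :
    (sigma d).real (capBall x s) ≤ (sigma d).real (capBall x r) + omega d * (s - r) := by
  refine (measureReal_mono (s₂ := capBall x r ∪ {p | geodist x p ∈ Icc r s}) fun p hp => ?_).trans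
    ((measureReal_union_le _ _).trans (add_le_add le_rfl (sigma_geodist_mem_le hd x hrs)))
  rcases le_total (geodist x p) r with h | h
  · exact Or.inl h
  · exact Or.inr ⟨h, hp⟩

end PolarSphere

/-! ### A lower bound for the measure of a lens -/

section Lens

theorem volume_ball_succ_le (k : ℕ) :
    volume (Metric.ball (0 : E k) 1) ≤
      2 * volume (Metric.ball (0 : EuclideanSpace ℝ (Fin k)) 1) := by
  have h : Metric.ball (0 : E k) 1 ⊆ (fun v : E k => (v 0, tail v)) ⁻¹'
      (Ioo (-1 : ℝ) 1 ×ˢ Metric.ball (0 : EuclideanSpace ℝ (Fin k)) 1) := by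
    intro v hv
    have hn := norm_sq_eq_head_tail v
    rw [mem_ball_zero_iff] at hv
    have hv2 : ‖v‖ ^ 2 < 1 := (sq_lt_one_iff₀ (norm_nonneg v)).2 hv
    refine ⟨abs_lt.1 ((sq_lt_one_iff_abs_lt_one _).1 ?_), mem_ball_zero_iff.2
      ((sq_lt_one_iff₀ (norm_nonneg _)).1 ?_)⟩
    · nlinarith [sq_nonneg ‖tail v‖]
    · nlinarith [sq_nonneg (v 0)]
  refine (measure_mono h).trans_eq ?_
  rw [measurePreserving_head_tail.measure_preimage
    (measurableSet_Ioo.prod Metric.isOpen_ball.measurableSet).nullMeasurableSet,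
    Measure.prod_prod, Real.volume_Ioo]
  norm_num

/-- The cone of vectors whose angle with the unit vector `e` has cosine at least `c`. -/
def angularCone {k : ℕ} (e : E k) (c : ℝ) : Set (E k) := {w | c * ‖w‖ ≤ inner ℝ e w}

theorem isCone_angularCone {k : ℕ} (e : E k) (c : ℝ) : IsCone (angularCone e c) := by
  intro r hr w
  simp only [angularCone, mem_ofPred_eq, norm_smul, Real.norm_of_nonneg hr.le, inner_smul_right,
    mul_left_comm c, mul_le_mul_iff_right₀ hr]

theorem measurableSet_angularCone {k : ℕ} (e : E k) (c : ℝ) :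
    MeasurableSet (angularCone e c) :=
  measurableSet_le (by fun_prop : Measurable fun w : E k => c * ‖w‖)
    (by fun_prop : Measurable fun w : E k => inner ℝ e w)

/-- A spherical cap of angular radius about `τ` occupies a fraction of the sphere `S^k` of the
order `τ ^ k`: the cone over it contains a cylinder of radius `τ / 2`. -/
theorem toSphere_angularCone_ge {k : ℕ} (e : Sph k) {τ : ℝ} (h0 : 0 < τ) (h1 : τ ≤ 1) :
    ENNReal.ofReal (omega (k + 1) / 8 * (τ / 2) ^ k) ≤
      sigma k {q | (q : E k) ∈ angularCone (e : E k) (1 - τ ^ 2 / 2)} := by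
  obtain ⟨g, hg⟩ := exists_isometry_head e
  set D := angularCone (e : E k) (1 - τ ^ 2 / 2) with hD
  -- in coordinates `(u, w)` along and orthogonal to `e`, the cylinder `1/2 < u < 3/4`,
  -- `‖w‖ < τ / 2` lies in the cone because `‖w‖ < τ u`
  have hsub : (fun v : E k => (g v 0, tail (g v))) ⁻¹'
      (Ioo (1 / 2 : ℝ) (3 / 4) ×ˢ Metric.ball (0 : EuclideanSpace ℝ (Fin k)) (τ / 2)) ⊆
      D ∩ Metric.ball 0 1 := by
    rintro v ⟨⟨hu1, hu2⟩, hw⟩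
    simp only at hu1 hu2 hw
    have hn : ‖v‖ ^ 2 = g v 0 ^ 2 + ‖tail (g v)‖ ^ 2 := by
      rw [← norm_sq_eq_head_tail, g.norm_map]
    rw [mem_ball_zero_iff] at hw
    have hw2 : ‖tail (g v)‖ ^ 2 ≤ (τ / 2) ^ 2 := by gcongr
    refine ⟨?_, ?_⟩
    · change (1 - τ ^ 2 / 2) * ‖v‖ ≤ inner ℝ (e : E k) v
      rw [← hg]
      set u := g v 0
      have hvu : ‖v‖ ≤ u * (1 + τ ^ 2 / 2) := by
        refine (sq_le_sq₀ (norm_nonneg v) (by nlinarith)).1 ?_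
        rw [hn]
        nlinarith [sq_nonneg (u * τ ^ 2), mul_pos h0 h0, mul_pos (mul_pos h0 h0)
          (by linarith : 0 < u - 1 / 2)]
      have hτ : 0 ≤ 1 - τ ^ 2 / 2 := by nlinarith
      calc (1 - τ ^ 2 / 2) * ‖v‖ ≤ (1 - τ ^ 2 / 2) * (u * (1 + τ ^ 2 / 2)) := by gcongr
        _ = u - u * (τ ^ 4 / 4) := by ring
        _ ≤ u := by
          have : 0 ≤ u * (τ ^ 4 / 4) := mul_nonneg (by linarith) (by positivity)
          linarith
    · rw [mem_ball_zero_iff, ← sq_lt_one_iff₀ (norm_nonneg v), hn]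
      nlinarith
  have hvol : ENNReal.ofReal ((τ / 2) ^ k) * volume (Metric.ball (0 : E k) 1) / 8 ≤
      volume (D ∩ Metric.ball 0 1) := by
    refine le_trans ?_ (measure_mono hsub)
    have hmp := (measurePreserving_head_tail (d := k)).comp g.measurePreserving
    have hmp' : volume ((fun v : E k => (g v 0, tail (g v))) ⁻¹'
        (Ioo (1 / 2 : ℝ) (3 / 4) ×ˢ Metric.ball (0 : EuclideanSpace ℝ (Fin k)) (τ / 2))) = _ :=
      hmp.measure_preimage
        (measurableSet_Ioo.prod Metric.isOpen_ball.measurableSet).nullMeasurableSet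
    have hball : volume (Metric.ball (0 : EuclideanSpace ℝ (Fin k)) (τ / 2)) =
        ENNReal.ofReal ((τ / 2) ^ k) * volume (Metric.ball (0 : EuclideanSpace ℝ (Fin k)) 1) := by
      rw [Measure.addHaar_ball_of_pos _ _ (by positivity : 0 < τ / 2), finrank_euclideanSpace_fin]
    rw [hmp', Measure.prod_prod, Real.volume_Ioo, hball]
    calc ENNReal.ofReal ((τ / 2) ^ k) * volume (Metric.ball (0 : E k) 1) / 8
        ≤ ENNReal.ofReal ((τ / 2) ^ k) *
          (2 * volume (Metric.ball (0 : EuclideanSpace ℝ (Fin k)) 1)) / 8 := by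
          gcongr
          exact volume_ball_succ_le k
      _ = (2 / 8) * (ENNReal.ofReal ((τ / 2) ^ k) *
          volume (Metric.ball (0 : EuclideanSpace ℝ (Fin k)) 1)) := by
          rw [mul_left_comm, ENNReal.mul_div_right_comm]
      _ = _ := by
          congr 1
          rw [show (3 / 4 - 1 / 2 : ℝ) = 2 / 8 by norm_num, ENNReal.ofReal_div_of_pos (by norm_num)]
          simp
  rw [sigma, toSphere_cone (isCone_angularCone _ _) (measurableSet_angularCone _ _)]
  refine le_trans (le_of_eq ?_) (mul_le_mul_right hvol _)
  have hom : ENNReal.ofReal (omega (k + 1)) =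
      Module.finrank ℝ (E k) * volume (Metric.ball (0 : E k) 1) := by
    rw [omega, ofReal_measureReal, Measure.toSphere_apply_univ]
  rw [ENNReal.ofReal_mul (div_nonneg (omega_nonneg _) (by norm_num)),
    ENNReal.ofReal_div_of_pos (by norm_num), hom]
  simp only [div_eq_mul_inv, ENNReal.ofReal_ofNat]
  ring

theorem two_div_pi_mul_le_sin {m t : ℝ} (hm : 0 ≤ m) (h1 : m ≤ t) (h2 : t ≤ Real.pi - m) :
    2 / Real.pi * m ≤ Real.sin t := by
  have hpi : 0 < 2 / Real.pi := by positivity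
  rcases le_total t (Real.pi / 2) with h | h
  · exact (mul_le_mul_of_nonneg_left h1 hpi.le).trans (Real.mul_le_sin (hm.trans h1) h)
  · rw [← Real.sin_pi_sub]
    exact (mul_le_mul_of_nonneg_left (by linarith) hpi.le).trans
      (Real.mul_le_sin (by linarith) (by linarith))

/-- The trigonometric inequality behind the lens: with `b = a + ε`, a point at distance `t` from
the centre `x`, slightly more than `2a`, and in almost the direction of `y`, is at distance at
most `b` from `y`. -/
theorem cos_le_of_mem_lens {a ε t : ℝ} (ha : 0 ≤ a) (hε : 0 < ε) (hε1 : ε ≤ 1)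
    (hεa : ε ≤ Real.pi - 2 * a) (ht1 : 2 * a ≤ t) (ht2 : t ≤ 2 * a + ε / 2) :
    Real.cos (a + ε) ≤
      Real.cos (a + ε) * Real.cos t + (1 - ε / 8) * Real.sin (a + ε) * Real.sin t := by
  obtain ⟨v, rfl⟩ : ∃ v, t = 2 * v := ⟨t / 2, by ring⟩
  have hpi := Real.pi_gt_three
  have hpi4 := Real.pi_le_four
  have hsv : 0 ≤ Real.sin v := Real.sin_nonneg_of_nonneg_of_le_pi (by linarith) (by linarith)
  have hsb : 0 ≤ Real.sin (a + ε) := Real.sin_nonneg_of_nonneg_of_le_pi (by linarith) (by linarith)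
  have h1 : Real.cos (a + ε) * Real.cos (2 * v) + Real.sin (a + ε) * Real.sin (2 * v) -
      Real.cos (a + ε) = 2 * Real.sin (a + ε - v) * Real.sin v := by
    rw [Real.cos_two_mul, Real.sin_two_mul, Real.sin_sub]
    linear_combination 2 * Real.cos (a + ε) * Real.sin_sq_add_cos_sq v
  have h2 : 3 * ε / 8 ≤ Real.sin (a + ε - v) := by
    have h := Real.mul_le_sin (x := a + ε - v) (by linarith) (by linarith)
    have h' : (1 / 2 : ℝ) ≤ 2 / Real.pi := by
      rw [div_le_div_iff₀ two_pos Real.pi_pos]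
      linarith
    nlinarith
  have h3 : Real.sin (a + ε) * Real.sin (2 * v) ≤ 2 * Real.sin v := by
    rw [Real.sin_two_mul]
    have e1 : Real.sin v * Real.cos v ≤ Real.sin v := mul_le_of_le_one_right hsv (Real.cos_le_one v)
    have e2 : Real.sin (a + ε) * Real.sin v ≤ Real.sin v :=
      mul_le_of_le_one_left hsv (Real.sin_le_one _)
    nlinarith
  nlinarith

/-- The part of the ball `B(y, a + ε)` outside of `B(x, 2a)`, where `d_s(x, y) = a + ε`, has
measure at least of the order `ε ^ ((d + 1) / 2)`. -/
theorem sigma_real_lens_ge {k : ℕ} {a ε m : ℝ} (ha : 0 < a) (hε : 0 < ε) (hε1 : ε ≤ 1)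
    (hεa : ε ≤ Real.pi - 2 * a) (hm0 : 0 ≤ m) (hma : m ≤ a) (hma' : m ≤ Real.pi / 2 - a)
    (x y : Sph (k + 1)) (hxy : geodist x y = a + ε) :
    omega (k + 1) / 16 * ε * (√ε * m / (2 * Real.pi)) ^ k ≤
      (sigma (k + 1)).real (capBall y (a + ε) \ capBall x (2 * a)) := by
  obtain ⟨g, hg⟩ := exists_isometry_head x
  obtain ⟨u, hu, hxu, hy⟩ := exists_direction (by omega) x y
  have hpi := Real.pi_gt_three
  have hgu0 : g u 0 = 0 := by rw [hg, hxu]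
  have hen : ‖tail (g u)‖ = 1 := by
    have h := norm_sq_eq_head_tail (g u)
    rw [hgu0, g.norm_map, hu] at h
    nlinarith [norm_nonneg (tail (g u))]
  let e : Sph k := ⟨tail (g u), mem_sphere_zero_iff_norm.2 hen⟩
  -- directions within the angle given by `τ = √ε / 2`, for which `1 - τ ^ 2 / 2 = 1 - ε / 8`
  have hτ0 : 0 < √ε / 2 := by positivity
  have hsq : √ε ^ 2 = ε := Real.sq_sqrt hε.le
  have hτ1 : √ε / 2 ≤ 1 := by nlinarith
  have hcap := toSphere_angularCone_ge e hτ0 hτ1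
  have hc : 1 - (√ε / 2) ^ 2 / 2 = 1 - ε / 8 := by rw [div_pow, hsq]; ring
  rw [hc] at hcap
  set T : Set ℝ := Ioc (2 * a) (2 * a + ε / 2)
  have hpolar := sigma_polar (d := k + 1) (by omega) g (T := T) measurableSet_Ioc
    (isCone_angularCone (e : E k) (1 - ε / 8)) (measurableSet_angularCone _ _)
  have hsub : {p : Sph (k + 1) | Real.arccos (g (p : E (k + 1)) 0) ∈ T ∧
      tail (g (p : E (k + 1))) ∈ angularCone (e : E k) (1 - ε / 8)} ⊆
      capBall y (a + ε) \ capBall x (2 * a) := by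
    rintro p ⟨hpT, hpD⟩
    rw [hg, ← geodist_eq_arccos] at hpT
    set t := geodist x p with ht
    refine ⟨?_, fun h => absurd hpT.1 (not_lt.2 h)⟩
    change (1 - ε / 8) * ‖tail (g (p : E (k + 1)))‖ ≤ inner ℝ (tail (g u)) (tail (g p)) at hpD
    have hst : 0 ≤ Real.sin t := InnerProductGeometry.sin_angle_nonneg _ _
    have hnt : ‖tail (g (p : E (k + 1)))‖ = Real.sin t := by
      have h := norm_sq_eq_head_tail (g (p : E (k + 1)))
      rw [g.norm_map, norm_coe_sph, hg, ← cos_geodist, ← ht] at h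
      exact (sq_eq_sq₀ (norm_nonneg _) hst).1 (by nlinarith [Real.sin_sq_add_cos_sq t])
    have hup : inner ℝ (tail (g u)) (tail (g (p : E (k + 1)))) = inner ℝ u (p : E (k + 1)) := by
      have h := inner_eq_head_tail (g u) (g (p : E (k + 1)))
      rw [g.inner_map_map, hgu0, zero_mul, zero_add] at h
      exact h.symm
    have hsb : 0 ≤ Real.sin (a + ε) :=
      Real.sin_nonneg_of_nonneg_of_le_pi (by linarith) (by linarith)
    have hyp : inner ℝ (y : E (k + 1)) (p : E (k + 1)) =
        Real.cos (a + ε) * Real.cos t + Real.sin (a + ε) * inner ℝ u (p : E (k + 1)) := by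
      rw [hy, inner_add_left, real_inner_smul_left, real_inner_smul_left, hxy, ht, cos_geodist]
    rw [hnt, hup] at hpD
    have h1 := cos_le_of_mem_lens ha.le hε hε1 hεa hpT.1.le hpT.2
    have h2 : Real.cos (a + ε) ≤ inner ℝ (y : E (k + 1)) (p : E (k + 1)) := by
      rw [hyp]
      nlinarith [mul_le_mul_of_nonneg_left hpD hsb]
    rw [mem_capBall, geodist_eq_arccos,
      ← Real.arccos_cos (by linarith : 0 ≤ a + ε) (by linarith)]
    exact Real.antitone_arccos h2
  -- `2a` and `2a + ε / 2` have distance at least `m` from `0` and `π`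
  have hint : ENNReal.ofReal ((2 / Real.pi * m) ^ k * (ε / 2)) ≤
      ∫⁻ t in T ∩ Ioo 0 Real.pi, ENNReal.ofReal (Real.sin t ^ (k + 1 - 1)) := by
    have hT : T ∩ Ioo 0 Real.pi = T :=
      inter_eq_left.2 fun t ht => ⟨by linarith [ht.1], by linarith [ht.2]⟩
    have hvol : volume T = ENNReal.ofReal (ε / 2) := by
      rw [Real.volume_Ioc]
      congr 1
      ring
    rw [hT, ENNReal.ofReal_mul (by positivity), ← hvol, ← setLIntegral_const]
    refine setLIntegral_mono (by fun_prop) fun t ht => ?_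
    refine ENNReal.ofReal_le_ofReal ?_
    rw [Nat.add_sub_cancel]
    gcongr
    exact two_div_pi_mul_le_sin hm0 (by linarith [ht.1]) (by linarith [ht.2])
  have hfin := (mul_le_mul' hcap hint).trans ((le_of_eq hpolar.symm).trans (measure_mono hsub))
  rw [← ENNReal.ofReal_mul (mul_nonneg (div_nonneg (omega_nonneg _) (by norm_num))
    (by positivity))] at hfin
  refine le_trans (le_of_eq ?_) ((ENNReal.ofReal_le_iff_le_toReal (measure_ne_top _ _)).1 hfin)
  have : √ε * m / (2 * Real.pi) = (√ε / 2 / 2) * (2 / Real.pi * m) := by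
    field_simp
  rw [this, mul_pow]
  ring

end Lens

/-! ### Counts of the Poisson process -/

section Poisson

theorem lintegral_id_poissonMeasure (r : NNReal) :
    ∫⁻ n, (n : ℝ≥0∞) ∂poissonMeasure r = r := by
  have hsum : ∑' n : ℕ, ENNReal.ofReal (Real.exp (-r) * r ^ n / n.factorial) = 1 := by
    have h := measure_univ (μ := poissonMeasure r)
    rw [← Measure.tsum_indicator_apply_singleton _ _ MeasurableSet.univ] at h
    simpa [poissonMeasure_singleton] using h
  rw [lintegral_countable', tsum_eq_zero_add' ENNReal.summable, Nat.cast_zero, zero_mul, zero_add]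
  have hterm : ∀ n : ℕ, ((n + 1 : ℕ) : ℝ≥0∞) * poissonMeasure r {n + 1} =
      r * ENNReal.ofReal (Real.exp (-r) * r ^ n / n.factorial) := by
    intro n
    rw [poissonMeasure_singleton, ← ENNReal.ofReal_natCast, ← ENNReal.ofReal_mul (by positivity),
      ← ENNReal.ofReal_coe_nnreal, ← ENNReal.ofReal_mul (by positivity), Nat.factorial_succ]
    congr 1
    push_cast
    field_simp
    ring
  rw [tsum_congr hterm, ENNReal.tsum_mul_left, hsum, mul_one]

variable {d : ℕ} {Ω : Type*} [MeasurableSpace Ω] {P : Measure Ω}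
  {X : Ω → Finset (Sph d)} {γ : ℝ}

theorem IsPoissonProcess.lintegral_count (h : IsPoissonProcess P X γ) {A : Set (Sph d)}
    (hA : MeasurableSet A) :
    ∫⁻ ω, (count (X ω) A : ℝ≥0∞) ∂P = ENNReal.ofReal (γ * (sigma d).real A) := by
  rw [← lintegral_map (f := fun n : ℕ => (n : ℝ≥0∞)) (by fun_prop) (h.measurable_count A hA),
    h.law_count A hA, lintegral_id_poissonMeasure]
  rfl

theorem IsPoissonProcess.prob_count_eq (h : IsPoissonProcess P X γ) (hγ : 0 ≤ γ) {A : Set (Sph d)}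
    (hA : MeasurableSet A) (n : ℕ) :
    P {ω | count (X ω) A = n} = ENNReal.ofReal
      (Real.exp (-(γ * (sigma d).real A)) * (γ * (sigma d).real A) ^ n / n.factorial) := by
  have h1 : P {ω | count (X ω) A = n} = P.map (fun ω => count (X ω) A) {n} := by
    rw [Measure.map_apply (h.measurable_count A hA) (measurableSet_singleton n)]
    rfl
  rw [h1, h.law_count A hA, poissonMeasure_singleton,
    Real.coe_toNNReal _ (mul_nonneg hγ measureReal_nonneg)]

theorem IsPoissonProcess.indepFun_count (h : IsPoissonProcess P X γ) {A D : Set (Sph d)}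
    (hA : MeasurableSet A) (hD : MeasurableSet D) (hAD : Disjoint A D) :
    IndepFun (fun ω => count (X ω) A) (fun ω => count (X ω) D) P := by
  have hi := h.indep_count 2 ![A, D] (by
    intro i
    fin_cases i
    exacts [hA, hD]) (by
    intro i j hij
    fin_cases i <;> fin_cases j
    exacts [absurd rfl hij, hAD, hAD.symm, absurd rfl hij])
  exact hi.indepFun (i := 0) (j := 1) (by decide)

/-- The expected number of points in `A` on the event that there is no point in `D`. -/
theorem IsPoissonProcess.lintegral_count_mul (h : IsPoissonProcess P X γ) (hγ : 0 ≤ γ)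
    {A D : Set (Sph d)} (hA : MeasurableSet A) (hD : MeasurableSet D) (hAD : Disjoint A D) :
    ∫⁻ ω, (count (X ω) A : ℝ≥0∞) * {ω | count (X ω) D = 0}.indicator 1 ω ∂P =
      ENNReal.ofReal (γ * (sigma d).real A) *
        ENNReal.ofReal (Real.exp (-(γ * (sigma d).real D))) := by
  have hi := (h.indepFun_count hA hD hAD).comp (φ := fun n : ℕ => (n : ℝ≥0∞))
    (ψ := ({0} : Set ℕ).indicator (1 : ℕ → ℝ≥0∞)) (by fun_prop) (by fun_prop)
  have hm0 : MeasurableSet {ω | count (X ω) D = 0} :=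
    h.measurable_count D hD (measurableSet_singleton 0)
  have h1 := lintegral_mul_eq_lintegral_mul_lintegral_of_indepFun
    ((by fun_prop : Measurable fun n : ℕ => (n : ℝ≥0∞)).comp (h.measurable_count A hA))
    ((by fun_prop : Measurable (({0} : Set ℕ).indicator (1 : ℕ → ℝ≥0∞))).comp
      (h.measurable_count D hD)) hi
  have h2 : ∫⁻ ω, ({0} : Set ℕ).indicator (1 : ℕ → ℝ≥0∞) (count (X ω) D) ∂P =
      ENNReal.ofReal (Real.exp (-(γ * (sigma d).real D))) := by
    have h3 := h.prob_count_eq hγ hD 0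
    rw [pow_zero, mul_one, Nat.factorial_zero, Nat.cast_one, div_one] at h3
    rw [← h3, ← lintegral_indicator_one hm0]
    rfl
  rw [← h.lintegral_count hA, ← h2]
  exact h1

/-- The probability that there is exactly one point in `A` and none in `D`. -/
theorem IsPoissonProcess.prob_count_one_zero (h : IsPoissonProcess P X γ) (hγ : 0 ≤ γ)
    {A D : Set (Sph d)} (hA : MeasurableSet A) (hD : MeasurableSet D) (hAD : Disjoint A D) :
    P {ω | count (X ω) A = 1 ∧ count (X ω) D = 0} =
      ENNReal.ofReal (γ * (sigma d).real A) *
        ENNReal.ofReal (Real.exp (-(γ * ((sigma d).real A + (sigma d).real D)))) := by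
  have h1 := (h.indepFun_count hA hD hAD).measure_inter_preimage_eq_mul {1} {0}
    (measurableSet_singleton _) (measurableSet_singleton _)
  have e1 := h.prob_count_eq hγ hA 1
  have e2 := h.prob_count_eq hγ hD 0
  rw [pow_one, Nat.factorial_one, Nat.cast_one, div_one] at e1
  rw [pow_zero, mul_one, Nat.factorial_zero, Nat.cast_one, div_one] at e2
  refine h1.trans ?_
  have hn : 0 ≤ γ * (sigma d).real A := mul_nonneg hγ measureReal_nonneg
  change P {ω | count (X ω) A = 1} * P {ω | count (X ω) D = 0} = _
  rw [e1, e2, ← ENNReal.ofReal_mul (by positivity), ← ENNReal.ofReal_mul hn]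
  congr 1
  rw [mul_add, neg_add, Real.exp_add]
  ring

theorem count_eq_card_filter (s : Finset (Sph d)) (A : Set (Sph d)) [DecidablePred (· ∈ A)] :
    count s A = (s.filter (· ∈ A)).card := by
  rw [count, ← Set.ncard_coe_finset]
  congr 1
  ext
  simp

theorem count_eq_zero_iff (s : Finset (Sph d)) (A : Set (Sph d)) :
    count s A = 0 ↔ ∀ z ∈ s, z ∉ A := by
  classical
  rw [count_eq_card_filter, Finset.card_eq_zero, Finset.filter_eq_empty_iff]

end Poisson

/-! ### The typical cell -/

section TypicalCell

variable {d : ℕ}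

/-- A finite Borel partition of the sphere into pieces of radius at most `δ`, encoded by the
function that maps a point to the index of its piece. -/
theorem exists_partition {δ : ℝ} (hδ : 0 < δ) :
    ∃ (n : ℕ) (c : Fin n → Sph d) (idx : Sph d → Fin n), Measurable idx ∧
      ∀ x, geodist (c (idx x)) x ≤ δ := by
  obtain ⟨t, -, ht⟩ := (isCompact_univ (X := Sph d)).elim_nhds_subcover
    (fun x => {y | geodist x y < δ}) fun x _ =>
      (isOpen_lt (continuous_geodist continuous_const continuous_id) continuous_const).mem_nhds
        (by rw [mem_ofPred_eq, id, geodist_self]; exact hδ)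
  let c : Fin t.card → Sph d := fun i => (t.equivFin.symm i : Sph d)
  have hcov : ∀ x, ∃ i, geodist (c i) x < δ := by
    intro x
    obtain ⟨y, hy, hxy⟩ := mem_iUnion₂.1 (ht (mem_univ x))
    exact ⟨t.equivFin ⟨y, hy⟩, by simpa [c] using hxy⟩
  have hmin : ∀ x, ∃ i, geodist (c i) x < δ ∧ ∀ j < i, ¬ geodist (c j) x < δ := by
    intro x
    obtain ⟨i, hi⟩ := exists_minimal_of_wellFoundedLT (fun i => geodist (c i) x < δ) (hcov x)
    exact ⟨i, hi.prop, fun j hj => hi.not_prop_of_lt hj⟩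
  choose idx h1 h2 using hmin
  refine ⟨t.card, c, idx, measurable_to_countable' fun i => ?_, fun x => (h1 x).le⟩
  have hopen : ∀ j, MeasurableSet {x | geodist (c j) x < δ} := fun j =>
    (isOpen_lt (continuous_geodist continuous_const continuous_id)
      continuous_const).measurableSet
  have : idx ⁻¹' {i} = {x | geodist (c i) x < δ} ∩
      ⋂ j, ⋂ (_ : j < i), {x | geodist (c j) x < δ}ᶜ := by
    ext x
    simp only [mem_preimage, mem_singleton_iff, mem_inter_iff, mem_ofPred_eq, mem_iInter,
      mem_compl_iff]
    constructor
    · rintro rfl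
      exact ⟨h1 x, h2 x⟩
    · rintro ⟨h3, h4⟩
      rcases lt_trichotomy (idx x) i with h | h | h
      · exact absurd (h1 x) (h4 _ h)
      · exact h
      · exact absurd h3 (h2 x _ h)
  rw [this]
  exact (hopen i).inter (MeasurableSet.iInter fun j =>
    MeasurableSet.iInter fun _ => (hopen j).compl)

theorem sum_sigma_real_fiber {n : ℕ} {idx : Sph d → Fin n} (hidx : Measurable idx) :
    ∑ i, (sigma d).real (idx ⁻¹' {i}) = omega (d + 1) := by
  rw [← measureReal_iUnion_fintype (fun i j hij => disjoint_left.2 fun x hi hj =>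
    hij (hi.symm.trans hj)) fun i => hidx (measurableSet_singleton i), ← sigma_real_univ]
  congr 1
  ext x
  simp

variable {Ω : Type*} [MeasurableSpace Ω] {P : Measure Ω} {X : Ω → Finset (Sph d)} {γ : ℝ}

open Classical in
/-- The distribution of the radii of the typical cell: the random rotations drop out. -/
theorem typicalCellProb_radii (hd : 1 ≤ d) (o : Sph d) (q : ℝ → ℝ → Prop) :
    typicalCellProb P X γ o {K | q (inrad o K) (circumrad o K)} =
      (ENNReal.ofReal (γ * omega (d + 1)))⁻¹ * ∫⁻ ω, ∑ x ∈ X ω,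
        if q (inrad x (voronoiCell x (X ω))) (circumrad x (voronoiCell x (X ω))) then 1 else 0
        ∂P := by
  rw [typicalCellProb]
  congr 1
  refine lintegral_congr fun ω => Finset.sum_congr rfl fun x _ => ?_
  refine kappa_setOf hd o x _ _ fun φ hφ => ?_
  rw [mem_ofPred_eq, inrad_inv_smul, circumrad_inv_smul, hφ]

/-- The distribution of the typical cell has total mass at most one. -/
theorem typicalCellProb_radii_le_one (hd : 1 ≤ d) (hX : IsPoissonProcess P X γ) (o : Sph d)
    (q : ℝ → ℝ → Prop) : typicalCellProb P X γ o {K | q (inrad o K) (circumrad o K)} ≤ 1 := by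
  classical
  rw [typicalCellProb_radii hd]
  refine le_trans (mul_le_mul_right ?_ _) (ENNReal.inv_mul_le_one _)
  rw [← sigma_real_univ, ← hX.lintegral_count MeasurableSet.univ]
  refine lintegral_mono fun ω => ?_
  rw [count_eq_card_filter, ← Finset.sum_boole]
  refine Finset.sum_le_sum fun x _ => ?_
  rw [if_pos (mem_univ x)]
  split_ifs <;> simp

open Classical in
/-- Decomposition of a sum over the points of the process according to a partition. -/
theorem sum_eq_sum_fiber {n : ℕ} (idx : Sph d → Fin n) (s : Finset (Sph d)) (f : Sph d → ℝ≥0∞) :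
    ∑ x ∈ s, f x = ∑ i, ∑ x ∈ s.filter (· ∈ idx ⁻¹' {i}), f x := by
  convert (Finset.sum_fiberwise s idx f).symm using 4
  exact Iff.rfl

/-- Lower bound for the probability that the typical cell contains the ball of radius `a`. -/
theorem ofReal_exp_le_typicalCellProb (hd : 1 ≤ d) (hγ : 0 < γ) (hX : IsPoissonProcess P X γ)
    (o : Sph d) {a δ : ℝ} (ha : 0 ≤ a) (ha' : a ≤ Real.pi) (hδ : 0 < δ) :
    ENNReal.ofReal (Real.exp (-(γ * (sigma d).real (capBall o (2 * a + δ))))) ≤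
      typicalCellProb P X γ o {K | a ≤ inrad o K} := by
  classical
  obtain ⟨n, c, idx, hidx, hc⟩ := exists_partition (d := d) hδ
  set v := (sigma d).real (capBall o (2 * a + δ)) with hv
  let A : Fin n → Set (Sph d) := fun i => idx ⁻¹' {i}
  let U : Fin n → Set (Sph d) := fun i => capBall (c i) (2 * a + δ)
  have hA : ∀ i, MeasurableSet (A i) := fun i => hidx (measurableSet_singleton i)
  have hU : ∀ i, MeasurableSet (U i) := fun i => measurableSet_capBall _ _
  have hAc : ∀ i, ∀ x ∈ A i, geodist (c i) x ≤ δ := by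
    rintro i x rfl
    exact hc x
  let S : Fin n → Set Ω := fun i =>
    {ω | count (X ω) (A i) = 1 ∧ count (X ω) (U i \ A i) = 0}
  have hS : ∀ i, MeasurableSet (S i) := fun i =>
    (hX.measurable_count _ (hA i) (measurableSet_singleton 1)).inter
      (hX.measurable_count _ ((hU i).diff (hA i)) (measurableSet_singleton 0))
  -- if a piece contains a single point and its neighbourhood no further one, the cell is large
  have hpt : ∀ ω, ∑ i, (S i).indicator (1 : Ω → ℝ≥0∞) ω ≤ ∑ x ∈ X ω,
      if a ≤ inrad x (voronoiCell x (X ω)) then 1 else 0 := by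
    intro ω
    rw [sum_eq_sum_fiber idx]
    refine Finset.sum_le_sum fun i _ => ?_
    by_cases hω : ω ∈ S i
    · rw [indicator_of_mem hω, Pi.one_apply]
      obtain ⟨h1, h2⟩ := hω
      rw [count_eq_card_filter, Finset.card_eq_one] at h1
      rw [count_eq_zero_iff] at h2
      obtain ⟨x, hx⟩ := h1
      have hxA : x ∈ X ω ∧ x ∈ A i := by
        rw [← Finset.mem_filter, hx]
        exact Finset.mem_singleton_self x
      have hin : a ≤ inrad x (voronoiCell x (X ω)) := by
        refine le_inrad_voronoiCell ha ha' fun z hz hzx => ?_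
        have hzA : z ∉ A i := fun h => hzx (Finset.mem_singleton.1 (by
          rw [← hx]
          exact Finset.mem_filter.2 ⟨hz, h⟩))
        have hzU : ¬ geodist (c i) z ≤ 2 * a + δ := fun h => h2 z hz ⟨h, hzA⟩
        have h3 := geodist_triangle (c i) x z
        have h4 := hAc i x hxA.2
        linarith
      change (1 : ℝ≥0∞) ≤ ∑ x ∈ (X ω).filter (· ∈ A i), _
      rw [hx, Finset.sum_singleton, if_pos hin]
    · rw [indicator_of_notMem hω]
      exact zero_le
  have hlow : ENNReal.ofReal (γ * omega (d + 1)) * ENNReal.ofReal (Real.exp (-(γ * v))) ≤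
      ∫⁻ ω, ∑ x ∈ X ω, (if a ≤ inrad x (voronoiCell x (X ω)) then 1 else 0) ∂P := by
    refine le_trans ?_ (lintegral_mono hpt)
    rw [lintegral_finsetSum _ fun i _ => measurable_one.indicator (hS i)]
    have hi : ∀ i, ∫⁻ ω, (S i).indicator (1 : Ω → ℝ≥0∞) ω ∂P =
        ENNReal.ofReal (γ * (sigma d).real (A i)) * ENNReal.ofReal (Real.exp (-(γ * v))) := by
      intro i
      rw [lintegral_indicator_one (hS i), hX.prob_count_one_zero hγ.le (hA i)
        ((hU i).diff (hA i)) disjoint_sdiff_right]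
      have hAU : A i ⊆ U i := fun x hx => (hAc i x hx).trans (by linarith)
      rw [← measureReal_union disjoint_sdiff_right ((hU i).diff (hA i)), union_sdiff_cancel hAU,
        hv, sigma_real_capBall_eq hd o (c i)]
    rw [Finset.sum_congr rfl fun i _ => hi i, ← Finset.sum_mul,
      ← ENNReal.ofReal_sum_of_nonneg fun i _ => mul_nonneg hγ.le measureReal_nonneg,
      ← Finset.mul_sum, sum_sigma_real_fiber hidx]
  have hγω : 0 < γ * omega (d + 1) := mul_pos hγ (omega_pos (by omega))
  rw [typicalCellProb_radii hd o fun r _ => a ≤ r, ← ENNReal.div_eq_inv_mul,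
    ENNReal.le_div_iff_mul_le (Or.inl (ENNReal.ofReal_pos.2 hγω).ne')
      (Or.inl ENNReal.ofReal_ne_top)]
  exact (mul_comm _ _).trans_le hlow

/-- The union of two shrunk balls with perturbed centres, up to a small piece `A`, has almost the
measure of the union of the original balls: the loss is at most a zone of width `3δ` for each of
the balls and a ball of radius `δ`. -/
theorem sigma_real_perturbed_union_ge (hd : 1 ≤ d) {r b δ : ℝ} (hδ : 0 ≤ δ) {x y x' y' : Sph d}
    (hx : geodist x' x ≤ δ) (hy : geodist y' y ≤ δ) {A : Set (Sph d)} (hA : A ⊆ capBall x' δ) :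
    (sigma d).real (capBall x r) + (sigma d).real (capBall y b \ capBall x r) -
        7 * δ * omega d ≤
      (sigma d).real ((capBall x' (r - 2 * δ) ∪ capBall y' (b - 2 * δ)) \ A) := by
  set D := capBall x' (r - 2 * δ) ∪ capBall y' (b - 2 * δ)
  have h1 : capBall x r ∪ (capBall y b \ capBall x r) ⊆ (D \ A) ∪ capBall x' δ ∪
      {p | geodist x p ∈ Icc (r - 3 * δ) r} ∪ {p | geodist y p ∈ Icc (b - 3 * δ) b} := by
    intro p hp
    by_cases hpA : p ∈ A
    · exact Or.inl (Or.inl (Or.inr (hA hpA)))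
    have hx' := geodist_triangle x' x p
    have hy' := geodist_triangle y' y p
    rcases hp with hp | ⟨hp, -⟩
    · rcases le_total (geodist x p) (r - 3 * δ) with h | h
      · refine Or.inl (Or.inl (Or.inl ⟨Or.inl ?_, hpA⟩))
        rw [mem_capBall]
        linarith
      · exact Or.inl (Or.inr ⟨h, hp⟩)
    · rcases le_total (geodist y p) (b - 3 * δ) with h | h
      · refine Or.inl (Or.inl (Or.inl ⟨Or.inr ?_, hpA⟩))
        rw [mem_capBall]
        linarith
      · exact Or.inr ⟨h, hp⟩
  have h2 := measureReal_mono (μ := sigma d) h1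
  rw [measureReal_union disjoint_sdiff_right
    ((measurableSet_capBall _ _).diff (measurableSet_capBall _ _))] at h2
  have h3 := measureReal_union_le (μ := sigma d)
    ((D \ A) ∪ capBall x' δ ∪ {p | geodist x p ∈ Icc (r - 3 * δ) r})
    {p | geodist y p ∈ Icc (b - 3 * δ) b}
  have h4 := measureReal_union_le (μ := sigma d) ((D \ A) ∪ capBall x' δ)
    {p | geodist x p ∈ Icc (r - 3 * δ) r}
  have h5 := measureReal_union_le (μ := sigma d) (D \ A) (capBall x' δ)
  have h6 := sigma_real_capBall_le hd x' hδ
  have h7 := sigma_geodist_mem_le hd x (by linarith : r - 3 * δ ≤ r)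
  have h8 := sigma_geodist_mem_le hd y (by linarith : b - 3 * δ ≤ b)
  nlinarith

/-- Upper bound for the probability that the typical cell contains the ball of radius `a` and
deviates from a ball by at least `ε`; the constant is the number of pieces of a fixed partition. -/
theorem exists_typicalCellProb_le (hd : 1 ≤ d) {a ε δ G : ℝ} (ha : 0 ≤ a) (hε : 0 < ε)
    (hδ : 0 < δ) (hG : ∀ x y : Sph d, geodist x y = a + ε →
      G ≤ (sigma d).real (capBall y (a + ε) \ capBall x (2 * a))) :
    ∃ N : ℝ, 0 ≤ N ∧ ∀ (o : Sph d) (γ : ℝ), 0 < γ →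
      ∀ (Ω : Type*) [MeasurableSpace Ω] (P : Measure Ω) (X : Ω → Finset (Sph d)),
        IsPoissonProcess P X γ →
        typicalCellProb P X γ o {K | ε ≤ circumrad o K - inrad o K ∧ a ≤ inrad o K} ≤
          ENNReal.ofReal (N * Real.exp (-(γ * ((sigma d).real (capBall o (2 * a)) + G -
            7 * δ * omega d)))) := by
  classical
  obtain ⟨n, c, idx, hidx, hc⟩ := exists_partition (d := d) hδ
  refine ⟨n, Nat.cast_nonneg n, fun o γ hγ Ω _ P X hX => ?_⟩
  set M := (sigma d).real (capBall o (2 * a)) + G - 7 * δ * omega d with hM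
  let A : Fin n → Set (Sph d) := fun i => idx ⁻¹' {i}
  let D : Fin n → Fin n → Set (Sph d) := fun i j =>
    capBall (c i) (2 * a - 2 * δ) ∪ capBall (c j) (a + ε - 2 * δ)
  have hA : ∀ i, MeasurableSet (A i) := fun i => hidx (measurableSet_singleton i)
  have hD : ∀ i j, MeasurableSet (D i j) := fun i j =>
    (measurableSet_capBall _ _).union (measurableSet_capBall _ _)
  have hAc : ∀ i, ∀ x ∈ A i, geodist (c i) x ≤ δ := by
    rintro i x rfl
    exact hc x
  -- the pairs of pieces that contain points at distance `a + ε`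
  let V : Fin n → Fin n → Prop := fun i j => ∃ x ∈ A i, ∃ y ∈ A j, geodist x y = a + ε
  let J : Fin n → Finset (Fin n) := fun i => Finset.univ.filter (V i)
  let S : Fin n → Fin n → Set Ω := fun i j => {ω | count (X ω) (D i j \ A i) = 0}
  have hS : ∀ i j, MeasurableSet (S i j) := fun i j =>
    hX.measurable_count _ ((hD i j).diff (hA i)) (measurableSet_singleton 0)
  let Q : Sph d → Finset (Sph d) → Prop := fun x s =>
    ε ≤ circumrad x (voronoiCell x s) - inrad x (voronoiCell x s) ∧ a ≤ inrad x (voronoiCell x s)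
  have hpt : ∀ ω, (∑ x ∈ X ω, if Q x (X ω) then (1 : ℝ≥0∞) else 0) ≤
      ∑ i, ∑ j ∈ J i, (count (X ω) (A i) : ℝ≥0∞) * (S i j).indicator 1 ω := by
    intro ω
    rw [sum_eq_sum_fiber idx]
    refine Finset.sum_le_sum fun i _ => ?_
    rw [← Finset.mul_sum, count_eq_card_filter, ← nsmul_eq_mul]
    refine Finset.sum_le_card_nsmul _ _ _ fun x hx => ?_
    obtain ⟨hxX, hxA⟩ := Finset.mem_filter.1 hx
    split_ifs with hQ
    -- `D i j`, for the piece `j` of `y`, lies in the two empty open balls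
    · obtain ⟨-, y, hxy, hy⟩ := exists_empty_ball_of_le_circumrad_sub_inrad hd ha hε hQ.2 hQ.1
      have hyA : y ∈ A (idx y) := rfl
      have hj : idx y ∈ J i := Finset.mem_filter.2 ⟨Finset.mem_univ _, x, hxA, y, hyA, hxy⟩
      refine le_trans (le_of_eq ?_)
        (Finset.single_le_sum (f := fun j => (S i j).indicator (1 : Ω → ℝ≥0∞) ω)
          (fun _ _ => bot_le) hj)
      refine (indicator_of_mem (f := (1 : Ω → ℝ≥0∞)) (show ω ∈ S i (idx y) from ?_)).symm
      change count (X ω) (D i (idx y) \ A i) = 0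
      rw [count_eq_zero_iff]
      rintro z hz ⟨hzD, hzA⟩
      have hzx : z ≠ x := fun h => hzA (h ▸ hxA)
      rcases hzD with hzD | hzD
      · have h1 := two_mul_le_geodist_of_le_inrad hd hQ.2 hz hzx
        have h2 := geodist_triangle x (c i) z
        have h3 := hAc i x hxA
        rw [geodist_comm] at h3
        rw [mem_capBall] at hzD
        linarith
      · have h1 := hy z hz
        have h2 := geodist_triangle y (c (idx y)) z
        have h3 := hc y
        rw [geodist_comm] at h3
        rw [mem_capBall] at hzD
        linarith
    · exact zero_le
  have hterm : ∀ i, ∀ j ∈ J i,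
      ∫⁻ ω, (count (X ω) (A i) : ℝ≥0∞) * (S i j).indicator 1 ω ∂P ≤
        ENNReal.ofReal (γ * (sigma d).real (A i)) * ENNReal.ofReal (Real.exp (-(γ * M))) := by
    intro i j hj
    obtain ⟨x, hx, y, hy, hxy⟩ := (Finset.mem_filter.1 hj).2
    rw [hX.lintegral_count_mul hγ.le (hA i) ((hD i j).diff (hA i)) disjoint_sdiff_right]
    gcongr
    have h1 := sigma_real_perturbed_union_ge hd (r := 2 * a) (b := a + ε) hδ.le (hAc i x hx)
      (hAc j y hy) (fun z hz => hAc i z hz : A i ⊆ capBall (c i) δ)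
    have h2 := hG x y hxy
    rw [sigma_real_capBall_eq hd x o] at h1
    linarith
  have hup : ∫⁻ ω, (∑ x ∈ X ω, if Q x (X ω) then (1 : ℝ≥0∞) else 0) ∂P ≤
      ENNReal.ofReal (γ * omega (d + 1)) * ENNReal.ofReal (n * Real.exp (-(γ * M))) := by
    have hmeas : ∀ i j, Measurable fun ω =>
        (count (X ω) (A i) : ℝ≥0∞) * (S i j).indicator 1 ω := fun i j =>
      ((by fun_prop : Measurable fun n : ℕ => (n : ℝ≥0∞)).comp
        (hX.measurable_count _ (hA i))).mul (measurable_one.indicator (hS i j))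
    refine (lintegral_mono hpt).trans ?_
    rw [lintegral_finsetSum _ fun i _ => Finset.measurable_sum _ fun j _ => hmeas i j]
    calc ∑ i, ∫⁻ ω, ∑ j ∈ J i, (count (X ω) (A i) : ℝ≥0∞) * (S i j).indicator 1 ω ∂P
        ≤ ∑ i, n * (ENNReal.ofReal (γ * (sigma d).real (A i)) *
            ENNReal.ofReal (Real.exp (-(γ * M)))) := by
          refine Finset.sum_le_sum fun i _ => ?_
          rw [lintegral_finsetSum _ fun j _ => hmeas i j]
          refine (Finset.sum_le_card_nsmul _ _ _ (hterm i)).trans ?_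
          rw [nsmul_eq_mul]
          gcongr
          exact (Finset.card_le_univ _).trans_eq (Fintype.card_fin n)
      _ = _ := by
          rw [← Finset.mul_sum, ← Finset.sum_mul,
            ← ENNReal.ofReal_sum_of_nonneg fun i _ => mul_nonneg hγ.le measureReal_nonneg,
            ← Finset.mul_sum, sum_sigma_real_fiber hidx, ENNReal.ofReal_mul (Nat.cast_nonneg n),
            ENNReal.ofReal_natCast]
          ring
  rw [typicalCellProb_radii hd o fun r R => ε ≤ R - r ∧ a ≤ r, ← ENNReal.div_eq_inv_mul]
  refine ENNReal.div_le_of_le_mul' ?_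
  convert hup

end TypicalCell

/-! ### Comparison of the constants -/

/-- The prescribed constant is strictly smaller than the one in the lower bound for the lens. -/
theorem prescribed_constant_lt {k : ℕ} {a ε m : ℝ} (ha : 0 < a) (ha' : a < Real.pi / 2)
    (hε : 0 < ε) (hm : 0 < m) :
    (Real.pi ^ (4 * (k + 1)))⁻¹ * omega (k + 1) * a ^ k * m ^ k *
        ε ^ ((((k + 1 : ℕ) : ℝ) + 1) / 2) <
      omega (k + 1) / 16 * ε * (√ε * m / (2 * Real.pi)) ^ k := by
  have hpi := Real.pi_gt_three
  have hω := omega_pos (n := k + 1) (by omega)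
  have hrpow : ε ^ ((((k + 1 : ℕ) : ℝ) + 1) / 2) = ε * √ε ^ k := by
    rw [show (((k + 1 : ℕ) : ℝ) + 1) / 2 = 1 + 1 / 2 * k by push_cast; ring, Real.rpow_add hε,
      Real.rpow_one, Real.rpow_mul hε.le, Real.rpow_natCast, Real.sqrt_eq_rpow]
  have h4 : 16 < Real.pi ^ 4 := by
    calc (16 : ℝ) = 2 ^ 4 := by norm_num
      _ < Real.pi ^ 4 := by gcongr; linarith
  have h1 : (Real.pi ^ 4)⁻¹ < 1 / 16 := by
    rw [one_div]
    exact inv_strictAnti₀ (by norm_num) h4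
  have h2 : (Real.pi ^ 4)⁻¹ * a ≤ 1 / (2 * Real.pi) := by
    rw [inv_mul_le_iff₀ (by positivity), mul_one_div, le_div_iff₀ (by positivity)]
    calc a * (2 * Real.pi) ≤ Real.pi ^ 2 := by nlinarith
      _ ≤ Real.pi ^ 4 := pow_le_pow_right₀ (by linarith) (by norm_num)
  have h3 : ((Real.pi ^ 4)⁻¹ * a) ^ k ≤ (1 / (2 * Real.pi)) ^ k := by gcongr
  have hpos : 0 < omega (k + 1) * ε * (√ε * m) ^ k := by
    have := Real.sqrt_pos.2 hε
    positivity
  calc (Real.pi ^ (4 * (k + 1)))⁻¹ * omega (k + 1) * a ^ k * m ^ k *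
        ε ^ ((((k + 1 : ℕ) : ℝ) + 1) / 2)
      = (omega (k + 1) * ε * (√ε * m) ^ k) * ((Real.pi ^ 4)⁻¹ * ((Real.pi ^ 4)⁻¹ * a) ^ k) := by
        rw [hrpow, pow_mul, ← inv_pow, pow_succ, mul_pow, mul_pow]
        ring
    _ < (omega (k + 1) * ε * (√ε * m) ^ k) * (1 / 16 * (1 / (2 * Real.pi)) ^ k) := by
        refine mul_lt_mul_of_pos_left (mul_lt_mul h1 h3 (by positivity) (by norm_num)) hpos
    _ = omega (k + 1) / 16 * ε * (√ε * m / (2 * Real.pi)) ^ k := by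
        rw [div_pow, div_pow, one_pow]
        ring

end SphericalVoronoi

end

theorem theorem10p2 (d : ℕ) (hd : 1 ≤ d) (a : ℝ) (ha : 0 < a) (ha' : a < Real.pi / 2) :
    ∃ c₁₆ : ℝ, 0 < c₁₆ ∧
      (Real.pi ^ (4 * d))⁻¹ * SphericalVoronoi.omega d * a ^ (d - 1) *
        (min a (Real.pi / 2 - a)) ^ (d - 1) ≤ c₁₆ ∧
      ∀ ε : ℝ, 0 < ε → ε ≤ 1 → ∃ c₁₅ : ℝ, 0 < c₁₅ ∧
        ∀ (o : SphericalVoronoi.Sph d) (γ : ℝ), 0 < γ →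
        ∀ (Ω : Type*) [MeasurableSpace Ω] (P : Measure Ω) [IsProbabilityMeasure P]
          (X : Ω → Finset (SphericalVoronoi.Sph d)),
          SphericalVoronoi.IsPoissonProcess P X γ →
          0 < SphericalVoronoi.typicalCellProb P X γ o
              {K | a ≤ SphericalVoronoi.inrad o K} ∧
          SphericalVoronoi.typicalCellProb P X γ o
              {K | a ≤ SphericalVoronoi.inrad o K} ≤ 1 ∧
          SphericalVoronoi.typicalCellCondProb P X γ o
              {K | ε ≤ SphericalVoronoi.circumrad o K - SphericalVoronoi.inrad o K}
              {K | a ≤ SphericalVoronoi.inrad o K} ≤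
            ENNReal.ofReal (c₁₅ * Real.exp (-(c₁₆ * ε ^ (((d : ℝ) + 1) / 2) * γ))) := by
  open SphericalVoronoi in
  obtain ⟨k, rfl⟩ : ∃ k, d = k + 1 := ⟨d - 1, by omega⟩
  rw [Nat.add_sub_cancel]
  have hpi := Real.pi_gt_three
  set m := min a (Real.pi / 2 - a) with hm
  have hm0 : 0 < m := lt_min ha (by linarith)
  have hω : 0 < omega (k + 1) := omega_pos (by omega)
  refine ⟨_, by positivity, le_rfl, fun ε hε hε1 => ?_⟩
  set c₁₆ := (Real.pi ^ (4 * (k + 1)))⁻¹ * omega (k + 1) * a ^ k * m ^ k with hc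
  have hle1 : ∀ (o : Sph (k + 1)) (γ : ℝ) (Ω : Type _) [MeasurableSpace Ω] (P : Measure Ω)
      (X : Ω → Finset (Sph (k + 1))), IsPoissonProcess P X γ →
      typicalCellProb P X γ o {K | a ≤ inrad o K} ≤ 1 := fun o γ Ω _ P X hX =>
    typicalCellProb_radii_le_one hd hX o fun r _ => a ≤ r
  have hpos : ∀ (o : Sph (k + 1)) (γ : ℝ), 0 < γ → ∀ (Ω : Type _) [MeasurableSpace Ω]
      (P : Measure Ω) (X : Ω → Finset (Sph (k + 1))), IsPoissonProcess P X γ →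
      0 < typicalCellProb P X γ o {K | a ≤ inrad o K} := fun o γ hγ Ω _ P X hX =>
    (ENNReal.ofReal_pos.2 (Real.exp_pos _)).trans_le
      (ofReal_exp_le_typicalCellProb hd hγ hX o ha.le (by linarith) one_pos)
  rcases lt_or_ge (Real.pi - 2 * a) ε with hεa | hεa
  -- here the event has probability zero
  · refine ⟨1, one_pos, fun o γ hγ Ω _ P _ X hX => ⟨hpos o γ hγ Ω P X hX, hle1 o γ Ω P X hX, ?_⟩⟩
    classical
    have h0 : typicalCellProb P X γ o ({K | ε ≤ circumrad o K - inrad o K} ∩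
        {K | a ≤ inrad o K}) = 0 := by
      have h := typicalCellProb_radii (P := P) (X := X) (γ := γ) hd o
        fun r R => ε ≤ R - r ∧ a ≤ r
      refine h.trans (mul_eq_zero.2 (Or.inr ((lintegral_congr fun ω =>
        Finset.sum_eq_zero fun x _ => if_neg ?_).trans lintegral_zero)))
      exact fun hQ => absurd (exists_empty_ball_of_le_circumrad_sub_inrad hd ha.le hε hQ.2 hQ.1).1
        (not_le.2 hεa)
    rw [typicalCellCondProb, h0, ENNReal.zero_div]
    exact zero_le
  · set G := omega (k + 1) / 16 * ε * (√ε * m / (2 * Real.pi)) ^ k with hGdef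
    have hG : c₁₆ * ε ^ ((((k + 1 : ℕ) : ℝ) + 1) / 2) < G :=
      prescribed_constant_lt ha ha' hε hm0
    -- the gap between the two constants pays for the discretization at scale `δ`
    obtain ⟨δ, hδ0, hδ⟩ : ∃ δ : ℝ, 0 < δ ∧
        8 * δ * omega (k + 1) = G - c₁₆ * ε ^ ((((k + 1 : ℕ) : ℝ) + 1) / 2) :=
      ⟨(G - c₁₆ * ε ^ ((((k + 1 : ℕ) : ℝ) + 1) / 2)) / (8 * omega (k + 1)),
        div_pos (by linarith) (by positivity), by field_simp⟩
    obtain ⟨N, hN0, hN⟩ := exists_typicalCellProb_le hd ha.le hε hδ0 (G := G) fun x y hxy =>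
      sigma_real_lens_ge ha hε hε1 hεa hm0.le (min_le_left _ _) (min_le_right _ _) x y hxy
    refine ⟨N + 1, by positivity, fun o γ hγ Ω _ P _ X hX =>
      ⟨hpos o γ hγ Ω P X hX, hle1 o γ Ω P X hX, ?_⟩⟩
    rw [typicalCellCondProb]
    refine ENNReal.div_le_of_le_mul ((hN o γ hγ Ω P X hX).trans ?_)
    refine le_trans ?_ (mul_le_mul_right
      (ofReal_exp_le_typicalCellProb hd hγ hX o ha.le (by linarith) hδ0) _)
    rw [← ENNReal.ofReal_mul (by positivity), mul_assoc (N + 1), ← Real.exp_add]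
    refine ENNReal.ofReal_le_ofReal (mul_le_mul (by linarith) ?_ (by positivity) (by positivity))
    refine Real.exp_le_exp.2 ?_
    have h1 := sigma_real_capBall_le_add hd o (by linarith : 2 * a ≤ 2 * a + δ)
    nlinarith
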